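/- Let $R$ be a commutative artinian ring and let $\Lambda$ be an artin $R$-algebra, that is, an $R$-algebra that is finitely generated as an $R$-module. All modules are left modules, and $\operatorname{mod}\Lambda$ is the category of finitely generated ones. Let $\widetilde Q=\bigoplus_i Q_i$, where the $Q_i$ are representatives of the isomorphism classes of indecomposable projective-injective $\Lambda$-modules, and let $\mathcal C_\Lambda\subseteq\operatorname{mod}\Lambda$ be the full subcategory of the modules $M$ for which there are an epimorphism $\widetilde Q^m\to M$ and a monomorphism $M\to\widetilde Q^{m'}$ for some $m,m'\ge 0$. A module is basic if it is a finite direct sum of pairwise non-isomorphic indecomposable modules. A basic module $T\in\operatorname{mod}\Lambda$ is partial tilting if $\operatorname{pd}T\le 1$ and $\operatorname{Ext}^1_\Lambda(T,T)=0$; it is tilting if moreover there is an exact sequence $0\to\Lambda\to T_0\to T_1\to 0$ with $T_0,T_1\in\operatorname{add}T$. A basic module $C\in\operatorname{mod}\Lambda$ is cotilting if $\operatorname{id}C\le 1$, $\operatorname{Ext}^1_\Lambda(C,C)=0$, and there is an exact sequence $0\to C_0\to C_1\to D\Lambda\to 0$ with $C_0,C_1\in\operatorname{add}C$, where $D=\operatorname{Hom}_R(-,J)$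 and $J$ is the injective envelope of $R/\operatorname{rad}R$. Write $\Omega^{-1}M$ for the cokernel of an injective envelope of $M$, and $\Omega M$ for the kernel of a projective cover of $M$. Let $\{X_i\}_{i\in \mathcal I}$ be representatives of the isomorphism classes of indecomposable modules in $\mathcal C_\Lambda$ of projective dimension exactly $1$. Then: 1. The index set $\mathcal I$ is finite. 2. With $X=\bigoplus_{i\in \mathcal I}X_i$, the module $\widetilde Q\oplus X$ is partial tilting. 3. If there is a tilting module $T_{\mathcal C}$ in $\mathcal C_\Lambda$, then it is unique up to isomorphism, and $$T_{\mathcal C}\cong\widetilde Q\oplus X\qquad\text{and}\qquad T_{\mathcal C}\cong\widetilde Q\oplus\bigoplus_i\Omega^{-1}P_i,$$ where $P_i$ runs over representatives of the isomorphism classes of indecomposable projective non-injective $\Lambda$-modules. 4. If there is a cotilting module $C_{\mathcal C}$ in $\mathcal C_\Lambda$, then it is unique up to isomorphism, and $$C_{\mathcal C}\cong\widetilde Q\oplus\bigoplus_i\Omega I_i,$$ where $I_i$ runs over representatives of the isomorphism classes of indecomposable injective non-projective $\Lambda$-modules. -/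

import Mathlib

open CategoryTheory

universe u

namespace TiltingC

section Envelopes

variable {A : Type u} [Ring A]

/-- `f : M → E` is an injective envelope: `E` is injective and `f` is an essential monomorphism. -/
structure IsInjectiveEnvelope {M E : ModuleCat.{u} A} (f : M →ₗ[A] E) : Prop where
  injective_module : Module.Injective A E
  mono : Function.Injective f
  essential : ∀ N : Submodule A E, N ⊓ LinearMap.range f = ⊥ → N = ⊥

/-- `f : P → M` is a projective cover: `P` is projective and `f` is an epimorphism with
superfluous kernel. -/
structure IsProjectiveCover {P M : ModuleCat.{u} A} (f : P →ₗ[A] M) : Prop where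
  projective_module : Module.Projective A P
  epi : Function.Surjective f
  superfluous : ∀ N : Submodule A P, N ⊔ LinearMap.ker f = ⊤ → N = ⊤

/-- `C` is (up to isomorphism) the cosyzygy `Ω⁻¹ M`, the cokernel of an injective envelope
of `M`. -/
def IsCosyzygy (M C : ModuleCat.{u} A) : Prop :=
  ∃ (E : ModuleCat.{u} A) (f : M →ₗ[A] E), IsInjectiveEnvelope f ∧
    Nonempty (C ≃ₗ[A] (E ⧸ LinearMap.range f))

/-- `K` is (up to isomorphism) the syzygy `Ω M`, the kernel of a projective cover of `M`. -/
def IsSyzygy (M K : ModuleCat.{u} A) : Prop :=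
  ∃ (P : ModuleCat.{u} A) (f : P →ₗ[A] M), IsProjectiveCover f ∧
    Nonempty (K ≃ₗ[A] LinearMap.ker f)

/-- If `K` is maximal with `K ⊓ E = ⊥`, then `E → J ⧸ K` is an essential monomorphism. -/
theorem exists_max_disjoint {J : Type u} [AddCommGroup J] [Module A J] (E : Submodule A J) :
    ∃ K : Submodule A J, K ⊓ E = ⊥ ∧ ∀ L, K ≤ L → L ⊓ E = ⊥ → L = K := by
  obtain ⟨K, -, hK⟩ := zorn_le_nonempty₀ {K : Submodule A J | K ⊓ E = ⊥} (by
    intro c hc hchain y hy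
    refine ⟨sSup c, ?_, fun z hz => le_sSup hz⟩
    rw [Set.mem_ofPred_eq, eq_bot_iff]
    rintro x ⟨hx1, hx2⟩
    obtain ⟨L, hL, hxL⟩ := (Submodule.mem_sSup_of_directed ⟨y, hy⟩ hchain.directedOn).1 hx1
    have : x ∈ L ⊓ E := ⟨hxL, hx2⟩
    rwa [hc hL] at this) ⊥ (by simp)
  exact ⟨K, hK.prop, fun L hL h => (hK.eq_of_le h hL).symm⟩

theorem exists_max_essential {J : Type u} [AddCommGroup J] [Module A J] (M : Submodule A J) :
    ∃ E : Submodule A J, (M ≤ E ∧ ∀ N ≤ E, N ⊓ M = ⊥ → N = ⊥) ∧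
      ∀ F, E ≤ F → (∀ N ≤ F, N ⊓ M = ⊥ → N = ⊥) → F = E := by
  obtain ⟨E, -, hE⟩ := zorn_le_nonempty₀
    {E : Submodule A J | M ≤ E ∧ ∀ N ≤ E, N ⊓ M = ⊥ → N = ⊥} (by
    intro c hc hchain y hy
    refine ⟨sSup c, ⟨(hc hy).1.trans (le_sSup hy), fun N hN h => ?_⟩, fun z hz => le_sSup hz⟩
    rw [eq_bot_iff]
    intro x hx
    obtain ⟨L, hL, hxL⟩ := (Submodule.mem_sSup_of_directed ⟨y, hy⟩ hchain.directedOn).1 (hN hx)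
    have h0 : N ⊓ L = ⊥ := (hc hL).2 _ inf_le_right (by
      rw [eq_bot_iff, ← h]; exact inf_le_inf_right _ inf_le_left)
    have : x ∈ N ⊓ L := ⟨hx, hxL⟩
    rwa [h0] at this) M ⟨le_rfl, fun N hN h => by rwa [inf_eq_left.2 hN] at h⟩
  exact ⟨E, hE.prop, fun F hF h => (hE.eq_of_le ⟨hE.prop.1.trans hF, h⟩ hF).symm⟩

/-- Every module has an injective envelope. -/
theorem exists_injectiveEnvelope (M : ModuleCat.{u} A) :
    ∃ (E : ModuleCat.{u} A) (f : M →ₗ[A] E), IsInjectiveEnvelope f := by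
  let J : ModuleCat.{u} A := Injective.under M
  let i : M →ₗ[A] J := (Injective.ι M).hom
  have hi : Function.Injective i := (ModuleCat.mono_iff_injective (Injective.ι M)).1 inferInstance
  have hJ : Module.Injective A J :=
    (Module.injective_iff_injective_object A J).2 (inferInstanceAs (Injective (Injective.under M)))
  obtain ⟨E, ⟨hME, hess⟩, hmax⟩ := exists_max_essential (LinearMap.range i)
  obtain ⟨K, hK, hKmax⟩ := exists_max_disjoint E
  let q : E →ₗ[A] J ⧸ K := K.mkQ ∘ₗ E.subtype
  have hq : Function.Injective q := by
    rw [← LinearMap.ker_eq_bot, eq_bot_iff]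
    intro x hx
    have h1 : (x : J) ∈ K := by simpa [q] using hx
    have : (x : J) ∈ K ⊓ E := ⟨h1, x.2⟩
    rw [hK] at this
    simpa using this
  have hqess : ∀ N : Submodule A (J ⧸ K), N ⊓ LinearMap.range q = ⊥ → N = ⊥ := by
    intro N hN
    have h1 : N.comap K.mkQ = K := by
      apply hKmax
      · intro x hx
        have : K.mkQ x = 0 := by simpa using hx
        simp only [Submodule.mem_comap, this, zero_mem]
      · rw [eq_bot_iff]
        rintro x ⟨hx1, hx2⟩
        have : K.mkQ x ∈ N ⊓ LinearMap.range q := ⟨hx1, ⟨⟨x, hx2⟩, rfl⟩⟩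
        rw [hN] at this
        have h2 : x ∈ K := by simpa using this
        have : x ∈ K ⊓ E := ⟨h2, hx2⟩
        rwa [hK] at this
    rw [eq_bot_iff]
    intro y hy
    obtain ⟨x, rfl⟩ := K.mkQ_surjective y
    have : x ∈ N.comap K.mkQ := hy
    rw [h1] at this
    simpa using this
  obtain ⟨h, hh⟩ := hJ.out q hq E.subtype
  have hinj : Function.Injective h := by
    rw [← LinearMap.ker_eq_bot]
    apply hqess
    rw [eq_bot_iff]
    rintro _ ⟨hx1, ⟨e, rfl⟩⟩
    have : E.subtype e = 0 := by rw [← hh e]; exact hx1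
    have he : e = 0 := by simpa using this
    simp [he]
  have hEr : LinearMap.range h = E := by
    apply hmax
    · intro x hx
      exact ⟨q ⟨x, hx⟩, hh ⟨x, hx⟩⟩
    · intro N hN h0
      have h1 : N ⊓ E = ⊥ := by
        apply hess _ inf_le_right
        rw [eq_bot_iff, ← h0]
        exact inf_le_inf_right _ inf_le_left
      have h2 : N.comap h = ⊥ := by
        apply hqess
        rw [eq_bot_iff]
        rintro _ ⟨hx1, ⟨e, rfl⟩⟩
        have : (e : J) ∈ N ⊓ E := ⟨by have h3 := hh e; rw [← show h (q e) = (e : J) from h3]; exact hx1, e.2⟩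
        rw [h1] at this
        have he : e = 0 := by simpa using this
        simp [he]
      rw [eq_bot_iff]
      intro x hx
      obtain ⟨y, rfl⟩ := hN hx
      have : y ∈ N.comap h := hx
      rw [h2] at this
      have hy : y = 0 := by simpa using this
      simp [hy]
  let r : J →ₗ[A] E := LinearMap.codRestrict E (h ∘ₗ K.mkQ) (fun x => hEr ▸ ⟨K.mkQ x, rfl⟩)
  have hr : ∀ e : E, r (e : J) = e := fun e => Subtype.ext (hh e)
  refine ⟨ModuleCat.of A E, LinearMap.codRestrict E i (fun x => hME ⟨x, rfl⟩), ?_, ?_, ?_⟩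
  · refine ⟨fun X Y _ _ _ _ f hf g => ?_⟩
    obtain ⟨g', hg'⟩ := hJ.out f hf (E.subtype ∘ₗ g)
    refine ⟨r ∘ₗ g', fun x => ?_⟩
    rw [LinearMap.comp_apply, hg' x]
    exact hr (g x)
  · intro x y hxy
    exact hi (congrArg Subtype.val hxy)
  · intro N hN
    change Submodule A E at N
    have h1 : N.map E.subtype = ⊥ := by
      apply hess
      · exact Submodule.map_subtype_le E N
      · rw [eq_bot_iff]
        rintro _ ⟨⟨e, he, rfl⟩, ⟨m, hm⟩⟩
        have h2 : e ∈ N ⊓ LinearMap.range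
            (LinearMap.codRestrict E i (fun x => hME ⟨x, rfl⟩)) := ⟨he, ⟨m, Subtype.ext hm⟩⟩
        have h3 : e ∈ (⊥ : Submodule A E) := hN ▸ h2
        have h4 : e = 0 := by simpa using h3
        simp [h4]
    rw [eq_bot_iff]
    intro e he
    have h2 : E.subtype e ∈ N.map E.subtype := ⟨e, he, rfl⟩
    rw [h1] at h2
    simpa using h2

/-- Over an artinian ring every finitely generated module has a projective cover. -/
theorem exists_projectiveCover [IsArtinianRing A] (M : ModuleCat.{u} A) [Module.Finite A M] :
    ∃ (P : ModuleCat.{u} A) (f : P →ₗ[A] M), Module.Finite A P ∧ IsProjectiveCover f := by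
  let S : Set ℕ∞ := {l | ∃ (P : ModuleCat.{u} A) (f : P →ₗ[A] M), Module.Finite A P ∧
    Module.Projective A P ∧ Function.Surjective f ∧ Module.length A P = l}
  have hS : S.Nonempty := by
    obtain ⟨n, f, hf⟩ := Module.Finite.exists_fin' A M
    exact ⟨_, ModuleCat.of A (Fin n → A), f, inferInstanceAs (Module.Finite A (Fin n → A)),
      inferInstanceAs (Module.Projective A (Fin n → A)), hf, rfl⟩
  obtain ⟨l, ⟨P, f, hfin, hproj, hf, hl⟩, hmin⟩ := wellFounded_lt.has_min S hS
  refine ⟨P, f, hfin, hproj, hf, fun N hN => ?_⟩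
  have hfN : Function.Surjective (f ∘ₗ N.subtype) := by
    intro y
    obtain ⟨x, rfl⟩ := hf y
    have hx : x ∈ N ⊔ LinearMap.ker f := hN ▸ Submodule.mem_top
    obtain ⟨a, ha, b, hb, rfl⟩ := Submodule.mem_sup.1 hx
    refine ⟨⟨a, ha⟩, ?_⟩
    have : f b = 0 := hb
    simp [this]
  obtain ⟨g, hg⟩ := Module.projective_lifting_property (f ∘ₗ N.subtype) f hfN
  let h : Module.End A P := N.subtype ∘ₗ g
  have hh : ∀ x, f (h x) = f x := fun x => LinearMap.congr_fun hg x
  have hpow : ∀ (n : ℕ) x, f ((h ^ n) x) = f x := by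
    intro n
    induction n with
    | zero => intro x; rfl
    | succ n ih => intro x; rw [pow_succ, Module.End.mul_apply, ih, hh]
  obtain ⟨n, hn, hc⟩ := ((Filter.eventually_ge_atTop 1).and
    (LinearMap.eventually_isCompl_ker_pow_range_pow h)).exists
  have hrange : LinearMap.range (h ^ n) = ⊤ := by
    by_contra hne
    refine hmin (Module.length A (LinearMap.range (h ^ n))) ?_ (hl ▸ Submodule.length_lt hne)
    refine ⟨ModuleCat.of A (LinearMap.range (h ^ n)), f ∘ₗ (LinearMap.range (h ^ n)).subtype,
      inferInstanceAs (Module.Finite A (LinearMap.range (h ^ n))), ?_, ?_, rfl⟩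
    · exact Module.Projective.of_split (LinearMap.range (h ^ n)).subtype
        (Submodule.projectionOnto _ _ hc.symm)
        (by ext x; simp)
    · intro y
      obtain ⟨x, rfl⟩ := hf y
      exact ⟨⟨(h ^ n) x, ⟨x, rfl⟩⟩, hpow n x⟩
  rw [eq_top_iff]
  intro x _
  have hx : x ∈ LinearMap.range (h ^ n) := hrange ▸ Submodule.mem_top
  obtain ⟨z, rfl⟩ := hx
  obtain ⟨m, rfl⟩ : ∃ m, n = m + 1 := ⟨n - 1, by omega⟩
  rw [pow_succ', Module.End.mul_apply]
  exact (g _).2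

end Envelopes

section Modules

variable {A : Type u} [Ring A]

/-- `M` is generated by `X`: a quotient of a finite direct sum of copies of `X`. -/
def IsGeneratedBy (X M : ModuleCat.{u} A) : Prop :=
  ∃ (m : ℕ) (f : (Fin m → X) →ₗ[A] M), Function.Surjective f

/-- `M` is cogenerated by `X`: a submodule of a finite direct sum of copies of `X`. -/
def IsCogeneratedBy (X M : ModuleCat.{u} A) : Prop :=
  ∃ (m : ℕ) (f : M →ₗ[A] (Fin m → X)), Function.Injective f

/-- `M` lies in `add X`: it is a direct summand of a finite direct sum of copies of `X`. -/
def IsInAdd (X M : ModuleCat.{u} A) : Prop :=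
  ∃ (m : ℕ) (N : ModuleCat.{u} A), Nonempty ((M × N) ≃ₗ[A] (Fin m → X))

/-- A basic module: a finite direct sum of pairwise non-isomorphic indecomposable modules. -/
def IsBasic (M : ModuleCat.{u} A) : Prop :=
  ∃ (n : ℕ) (N : Fin n → ModuleCat.{u} A), (∀ i, Indecomposable (N i)) ∧
    (∀ i j, Nonempty (N i ≃ₗ[A] N j) → i = j) ∧ Nonempty (M ≃ₗ[A] (∀ i, N i))

/-- The family `N` consists of representatives of the isomorphism classes of all modules with the
property `p`, each class being represented exactly once. -/
structure IsRepresentatives (p : ModuleCat.{u} A → Prop) {ι : Type u}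
    (N : ι → ModuleCat.{u} A) : Prop where
  prop : ∀ i, p (N i)
  unique : ∀ i j, Nonempty (N i ≃ₗ[A] N j) → i = j
  exists_iso : ∀ M, p M → ∃ i, Nonempty (M ≃ₗ[A] N i)

/-- Representatives exist for every isomorphism-invariant property of finitely generated
modules. -/
theorem exists_isRepresentatives (p : ModuleCat.{u} A → Prop) (hp : ∀ M, p M → Module.Finite A M)
    (hiso : ∀ M N : ModuleCat.{u} A, Nonempty (M ≃ₗ[A] N) → p M → p N) :
    ∃ (ι : Type u) (N : ι → ModuleCat.{u} A), IsRepresentatives p N := by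
  let C := {x : Σ n : ℕ, Submodule A (Fin n → A) // p (ModuleCat.of A ((Fin x.1 → A) ⧸ x.2))}
  let r : Setoid C :=
    { r := fun x y => Nonempty (((Fin x.1.1 → A) ⧸ x.1.2) ≃ₗ[A] ((Fin y.1.1 → A) ⧸ y.1.2))
      iseqv := ⟨fun _ => ⟨LinearEquiv.refl _ _⟩, fun ⟨e⟩ => ⟨e.symm⟩,
        fun ⟨e⟩ ⟨e'⟩ => ⟨e.trans e'⟩⟩ }
  refine ⟨Quotient r, fun q => ModuleCat.of A ((Fin q.out.1.1 → A) ⧸ q.out.1.2), ?_, ?_, ?_⟩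
  · exact fun q => q.out.2
  · exact fun i j h => Quotient.out_equiv_out.1 h
  · intro M hM
    have := hp M hM
    obtain ⟨n, f, hf⟩ := Module.Finite.exists_fin' A M
    have e : ((Fin n → A) ⧸ LinearMap.ker f) ≃ₗ[A] M := f.quotKerEquivOfSurjective hf
    let c : C := ⟨⟨n, LinearMap.ker f⟩, hiso M _ ⟨e.symm⟩ hM⟩
    obtain ⟨e'⟩ := Quotient.mk_out (s := r) c
    exact ⟨Quotient.mk r c, ⟨e.symm.trans e'.symm⟩⟩

/-- Finitely generated indecomposable projective-injective modules. -/
def IsIndecProjInj (M : ModuleCat.{u} A) : Prop :=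
  Module.Finite A M ∧ Indecomposable M ∧ Module.Projective A M ∧ Module.Injective A M

/-- Finitely generated indecomposable projective non-injective modules. -/
def IsIndecProjNonInj (M : ModuleCat.{u} A) : Prop :=
  Module.Finite A M ∧ Indecomposable M ∧ Module.Projective A M ∧ ¬ Module.Injective A M

/-- Finitely generated indecomposable injective non-projective modules. -/
def IsIndecInjNonProj (M : ModuleCat.{u} A) : Prop :=
  Module.Finite A M ∧ Indecomposable M ∧ Module.Injective A M ∧ ¬ Module.Projective A M

open scoped DirectSum in
/-- The direct sum of a family of modules. -/
def sumOf {ι : Type u} (N : ι → ModuleCat.{u} A) : ModuleCat.{u} A :=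
  ModuleCat.of A (⨁ i, N i)

/-- The category `𝒞 = Gen Q ∩ Cogen Q` of finitely generated modules. -/
structure IsInC (Q M : ModuleCat.{u} A) : Prop where
  finite : Module.Finite A M
  gen : IsGeneratedBy Q M
  cogen : IsCogeneratedBy Q M

/-- Finitely generated indecomposable modules in `𝒞` of projective dimension exactly one. -/
def IsIndecInCOfPdOne (Q M : ModuleCat.{u} A) : Prop :=
  Indecomposable M ∧ IsInC Q M ∧ projectiveDimension M = 1

/-- Partial tilting modules (in the classical sense; basic and finitely generated). -/
structure IsPartialTilting (T : ModuleCat.{u} A) : Prop where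
  finite : Module.Finite A T
  basic : IsBasic T
  pd_le_one : projectiveDimension T ≤ 1
  ext_self : Subsingleton (Abelian.Ext T T 1)

/-- Tilting modules: partial tilting, with an exact sequence `0 → A → T₀ → T₁ → 0`,
`T₀, T₁ ∈ add T`. -/
structure IsTilting (T : ModuleCat.{u} A) : Prop extends IsPartialTilting T where
  exists_coresolution : ∃ (T₀ T₁ : ModuleCat.{u} A) (f : A →ₗ[A] T₀) (g : T₀ →ₗ[A] T₁),
    IsInAdd T T₀ ∧ IsInAdd T T₁ ∧
    Function.Injective f ∧ Function.Exact f g ∧ Function.Surjective g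

end Modules

section Duality

variable (R : Type u) [CommRing R] (A : Type u) [Ring A] [Algebra R A]

/-- An injective envelope of `R ⧸ rad R` over the commutative ring `R`. -/
noncomputable def dualizingModule : ModuleCat.{u} R :=
  (exists_injectiveEnvelope (ModuleCat.of R (R ⧸ Ring.jacobson R))).choose

/-- The underlying type of `D A = Hom_R(A, J)`, `J` the injective envelope of `R ⧸ rad R`. -/
def DualRegular : Type u := A →ₗ[R] dualizingModule R

noncomputable instance : AddCommGroup (DualRegular R A) :=
  inferInstanceAs (AddCommGroup (A →ₗ[R] dualizingModule R))

/-- The left `A`-module structure of `D A`, which comes from the right module `A`: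
`(a • φ) x = φ (x * a)`. -/
noncomputable instance : Module A (DualRegular R A) where
  smul a φ := LinearMap.comp (show A →ₗ[R] dualizingModule R from φ) (LinearMap.mulRight R a)
  one_smul φ := LinearMap.ext fun x => congrArg φ.toFun (mul_one x)
  mul_smul a b φ := LinearMap.ext fun x => congrArg φ.toFun (mul_assoc x a b).symm
  smul_zero _ := rfl
  smul_add _ _ _ := rfl
  add_smul a b φ := LinearMap.ext fun x =>
    (congrArg φ.toFun (mul_add x a b)).trans (LinearMap.map_add φ (x * a) (x * b))
  zero_smul φ := LinearMap.ext fun x =>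
    (congrArg φ.toFun (mul_zero x)).trans (LinearMap.map_zero φ)

variable {A}

/-- Cotilting modules (basic and finitely generated) over the artin `R`-algebra `A`:
`id C ≤ 1`, `Ext¹(C, C) = 0`, and there is an exact sequence `0 → C₀ → C₁ → D A → 0` with
`C₀, C₁ ∈ add C`. -/
structure IsCotilting (C : ModuleCat.{u} A) : Prop where
  finite : Module.Finite A C
  basic : IsBasic C
  id_le_one : injectiveDimension C ≤ 1
  ext_self : Subsingleton (Abelian.Ext C C 1)
  exists_resolution : ∃ (C₀ C₁ : ModuleCat.{u} A) (f : C₀ →ₗ[A] C₁)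
    (g : C₁ →ₗ[A] DualRegular R A), IsInAdd C C₀ ∧ IsInAdd C C₁ ∧
    Function.Injective f ∧ Function.Exact f g ∧ Function.Surjective g

end Duality

end TiltingC

open TiltingC

/-! Finitely generated modules over Λ have finite length, so indecomposable ones have local
endomorphism rings (Fitting) and Krull–Schmidt arguments apply. The main tool,
`isRetractOf_right_or_middle`, compares two short exact sequences. If the left end of the first is a
summand of the left end of the second, compatibly with maps both ways between the middle terms, then
its right end, when it has local endomorphism ring, is a summand of the second right end or of its
own middle term. `isRetractOf_left_or_middle` is the dual.

Let P be indecomposable projective, not injective, and embedded in a projective-injective module.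
Its injective envelope E is then projective, and 0 → P → E → Ω⁻¹P → 0 determines both ends from each
other: Ω⁻¹P is not projective, has local endomorphism ring, and recovers P. Conversely, an
indecomposable X in 𝒞 of projective dimension one is the cokernel of a projective K in a
projective-injective G. Comparing this with the injective envelopes of the indecomposable summands
of K shows that X is some Ω⁻¹P_j, the alternative being that X is a summand of G and so projective.
As there are finitely many P_j, there are finitely many X_i. Finally, Ext¹(T, M) vanishes whenever
pd T ≤ 1 and M is a quotient of an injective module, which makes Q̃ ⊕ X partial tilting.

For a tilting T in 𝒞, comparing 0 → P → E → Ω⁻¹P → 0 with a power of the coresolution of Λ makes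
every Ω⁻¹P_j a summand of T; the Q_i are summands because they embed in powers of T₀. A summand of T
is in 𝒞 with projective dimension at most one, so it is a Q_i or an X_i. Since T is basic,
`IsBasic.nonempty_equiv_pi` identifies it. The cotilting case is dual, with DΛ as cogenerator in
place of the generator Λ. -/

namespace TiltingC

/-! ### Direct summands, local endomorphism rings and decompositions into indecomposables. -/

section KrullSchmidt

variable {A : Type u} [Ring A]

/-- `M` is isomorphic to a direct summand of `N`. -/
def IsRetractOf (A : Type u) [Ring A] (M N : Type u) [AddCommGroup M] [Module A M]
    [AddCommGroup N] [Module A N] : Prop :=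
  ∃ (s : M →ₗ[A] N) (r : N →ₗ[A] M), ∀ x, r (s x) = x

section

variable {M N K : Type u} [AddCommGroup M] [Module A M] [AddCommGroup N] [Module A N]
  [AddCommGroup K] [Module A K]

theorem IsRetractOf.of_equiv (e : M ≃ₗ[A] N) : IsRetractOf A M N :=
  ⟨e, e.symm, e.symm_apply_apply⟩

theorem IsRetractOf.trans (h : IsRetractOf A M N) (h' : IsRetractOf A N K) :
    IsRetractOf A M K := by
  obtain ⟨s, r, h⟩ := h
  obtain ⟨s', r', h'⟩ := h'
  exact ⟨s' ∘ₗ s, r ∘ₗ r', fun x => by simp [h, h']⟩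

theorem IsRetractOf.of_isUnit {s : M →ₗ[A] N} {r : N →ₗ[A] M}
    (h : IsUnit (r ∘ₗ s : Module.End A M)) : IsRetractOf A M N := by
  obtain ⟨u, hu⟩ := h
  refine ⟨s, (↑u⁻¹ : Module.End A M) ∘ₗ r, fun x => ?_⟩
  have := LinearMap.congr_fun u.inv_mul x
  rw [hu] at this
  exact this

theorem IsRetractOf.finite (h : IsRetractOf A M N) [Module.Finite A N] : Module.Finite A M := by
  obtain ⟨s, r, h⟩ := h
  exact Module.Finite.of_surjective r fun x => ⟨s x, h x⟩

theorem IsRetractOf.projective (h : IsRetractOf A M N) [Module.Projective A N] :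
    Module.Projective A M := by
  obtain ⟨s, r, h⟩ := h
  exact Module.Projective.of_split s r (LinearMap.ext h)

theorem IsRetractOf.injective (h : IsRetractOf A M N) [hN : Module.Injective A N] :
    Module.Injective A M := by
  obtain ⟨s, r, h⟩ := h
  refine ⟨fun X Y _ _ _ _ f hf g => ?_⟩
  obtain ⟨k, hk⟩ := hN.out f hf (s ∘ₗ g)
  exact ⟨r ∘ₗ k, fun x => by simp [hk, h]⟩

theorem IsRetractOf.of_injective [hM : Module.Injective A M] (f : M →ₗ[A] N)
    (hf : Function.Injective f) : IsRetractOf A M N := by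
  obtain ⟨r, hr⟩ := hM.out f hf LinearMap.id
  exact ⟨f, r, hr⟩

theorem IsRetractOf.of_surjective [Module.Projective A M] (f : N →ₗ[A] M)
    (hf : Function.Surjective f) : IsRetractOf A M N := by
  obtain ⟨s, hs⟩ := Module.projective_lifting_property f LinearMap.id hf
  exact ⟨s, f, LinearMap.congr_fun hs⟩

theorem IsRetractOf.of_equiv_pi {ι : Type*} {N : ι → Type u} [∀ i, AddCommGroup (N i)]
    [∀ i, Module A (N i)] (e : M ≃ₗ[A] ∀ i, N i) (i : ι) : IsRetractOf A (N i) M := by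
  classical
  exact ⟨e.symm.toLinearMap ∘ₗ LinearMap.single A N i, LinearMap.proj i ∘ₗ e.toLinearMap,
    fun x => by simp⟩

theorem eq_zero_or_eq_one_of_isIdempotentElem {B : Type*} [Ring B] [IsLocalRing B] {e : B}
    (he : e * e = e) : e = 0 ∨ e = 1 := by
  rcases IsLocalRing.isUnit_or_isUnit_of_add_one (add_sub_cancel e 1) with h | h
  · exact Or.inr (h.mul_left_cancel (by rw [he, mul_one]))
  · exact Or.inl (h.mul_left_cancel (by rw [sub_mul, he]; simp))

theorem nontrivial_of_isLocalRing_end [IsLocalRing (Module.End A M)] : Nontrivial M := by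
  by_contra h
  rw [not_nontrivial_iff_subsingleton] at h
  exact one_ne_zero (α := Module.End A M) (LinearMap.ext fun x => Subsingleton.elim _ _)

/-- The composite `s ∘ r` is idempotent in a local ring, hence 0 or 1; it cannot be 0 because `M` is
nonzero. -/
theorem IsRetractOf.nonempty_equiv [Nontrivial M] [IsLocalRing (Module.End A N)]
    (h : IsRetractOf A M N) : Nonempty (M ≃ₗ[A] N) := by
  obtain ⟨s, r, h⟩ := h
  have he : (s ∘ₗ r : Module.End A N) * (s ∘ₗ r) = s ∘ₗ r := LinearMap.ext fun x => by simp [h]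
  rcases eq_zero_or_eq_one_of_isIdempotentElem he with h0 | h1
  · obtain ⟨x, hx⟩ := exists_ne (0 : M)
    refine absurd ?_ hx
    have := LinearMap.congr_fun h0 (s x)
    rw [← h x, ← h (r (s x))]
    simp only [LinearMap.comp_apply] at this
    rw [this]; simp
  · exact ⟨LinearEquiv.ofLinearMap s r h1 (LinearMap.ext h)⟩

/-- The composite `r ∘ s` is the sum of its passages through the factors, and in a local ring a sum
that is a unit has a unit summand. -/
theorem IsRetractOf.exists_of_pi {ι : Type*} [Finite ι] [IsLocalRing (Module.End A M)]
    {N : ι → Type u} [∀ i, AddCommGroup (N i)] [∀ i, Module A (N i)]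
    {s : M →ₗ[A] ∀ i, N i} {r : (∀ i, N i) →ₗ[A] M} (h : IsUnit (r ∘ₗ s : Module.End A M)) :
    ∃ i, IsRetractOf A M (N i) := by
  classical
  have := Fintype.ofFinite ι
  have h1 : (r ∘ₗ s : Module.End A M) = ∑ i, (r ∘ₗ LinearMap.single A N i) ∘ₗ
      (LinearMap.proj i ∘ₗ s) := by
    ext x
    simp only [LinearMap.comp_apply, LinearMap.sum_apply, LinearMap.proj_apply]
    rw [← map_sum]
    congr 1
    exact (LinearMap.sum_single_apply N (s x)).symm
  rw [h1] at h
  obtain ⟨i, -, hi⟩ := IsLocalRing.exists_of_isUnit_sum h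
  exact ⟨i, .of_isUnit hi⟩

theorem IsRetractOf.exists_pi {ι : Type*} [Finite ι] [IsLocalRing (Module.End A M)]
    {N : ι → Type u} [∀ i, AddCommGroup (N i)] [∀ i, Module A (N i)]
    {L : Type u} [AddCommGroup L] [Module A L] (e : L ≃ₗ[A] ∀ i, N i) (h : IsRetractOf A M L) :
    ∃ i, IsRetractOf A M (N i) := by
  obtain ⟨s, r, h⟩ := h
  refine exists_of_pi (s := e.toLinearMap ∘ₗ s) (r := r ∘ₗ e.symm.toLinearMap) ?_
  convert isUnit_one using 1
  exact LinearMap.ext fun x => by simp [h]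

end

theorem indecomposable_iff_isCompl (M : ModuleCat.{u} A) : Indecomposable M ↔
    Nontrivial M ∧ ∀ K L : Submodule A M, IsCompl K L → K = ⊥ ∨ L = ⊥ := by
  simp only [Indecomposable, ModuleCat.isZero_iff_subsingleton, not_subsingleton_iff_nontrivial]
  refine and_congr_right fun _ => ⟨fun h K L hKL => ?_, fun h Y Z e => ?_⟩
  · have e : M ≅ ModuleCat.of A K ⊞ ModuleCat.of A L :=
      (Submodule.prodEquivOfIsCompl K L hKL).symm.toModuleIso ≪≫
        (ModuleCat.biprodIsoProd (ModuleCat.of A K) (ModuleCat.of A L)).symm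
    rw [← Submodule.subsingleton_iff_eq_bot, ← Submodule.subsingleton_iff_eq_bot]
    exact h _ _ e
  · let e' : M ≃ₗ[A] Y × Z := (e ≪≫ ModuleCat.biprodIsoProd Y Z).toLinearEquiv
    have hc := LinearMap.isCompl_range_inl_inr (R := A) (M := Y) (M₂ := Z)
    have := h _ _ (hc.map (Submodule.orderIsoMapComap e'.symm))
    simp only [Submodule.orderIsoMapComap_apply, Submodule.map_eq_bot_iff] at this
    refine this.imp (fun h => ⟨fun x y => ?_⟩) (fun h => ⟨fun x y => ?_⟩)
    · have := LinearMap.range_eq_bot.1 h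
      simpa using congrArg Prod.fst ((LinearMap.congr_fun this x).trans
        (LinearMap.congr_fun this y).symm)
    · have := LinearMap.range_eq_bot.1 h
      simpa using congrArg Prod.snd ((LinearMap.congr_fun this x).trans
        (LinearMap.congr_fun this y).symm)

/-- Fitting's lemma: kernel and range of a high power of `f` are complementary, so `f` is either
invertible or nilpotent, and in the latter case `1 - f` is invertible. -/
theorem isLocalRing_end_of_indecomposable (M : ModuleCat.{u} A) [IsArtinian A M]
    [IsNoetherian A M] (h : Indecomposable M) : IsLocalRing (Module.End A M) := by
  obtain ⟨hM, h⟩ := (indecomposable_iff_isCompl M).1 h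
  refine .of_isUnit_or_isUnit_one_sub_self fun f => ?_
  obtain ⟨n, hn, hc⟩ := ((Filter.eventually_ge_atTop 1).and
    (LinearMap.eventually_isCompl_ker_pow_range_pow f)).exists
  rcases h _ _ hc with h0 | h0
  · left
    have h1 : LinearMap.range (f ^ n) = ⊤ := by
      have := hc.sup_eq_top
      rwa [h0, bot_sup_eq] at this
    refine (isUnit_pow_iff (n := n) (by omega)).1 ?_
    exact (Module.End.isUnit_iff _).2 ⟨LinearMap.ker_eq_bot.1 h0, LinearMap.range_eq_top.1 h1⟩
  · right
    exact IsNilpotent.isUnit_one_sub ⟨n, LinearMap.range_eq_bot.1 h0⟩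

theorem exists_indecomposable_decomposition (M : ModuleCat.{u} A) [IsArtinian A M]
    [IsNoetherian A M] : ∃ (ι : Type) (_ : Finite ι) (N : ι → ModuleCat.{u} A),
      (∀ i, Indecomposable (N i)) ∧ Nonempty (M ≃ₗ[A] ∀ i, N i) := by
  -- Induction on a bound for the length: in a proper decomposition each part has length at least
  -- one, so the other part is strictly shorter than `M`.
  suffices H : ∀ (l : ℕ) (M : ModuleCat.{u} A), Module.length A M ≤ l → ∃ (ι : Type) (_ : Finite ι)
      (N : ι → ModuleCat.{u} A), (∀ i, Indecomposable (N i)) ∧ Nonempty (M ≃ₗ[A] ∀ i, N i) by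
    have : Module.length A M ≠ ⊤ := Module.length_ne_top
    exact H _ M (ENat.natCast_toNat this).ge
  intro l
  have empty : ∀ M : ModuleCat.{u} A, Subsingleton M → ∃ (ι : Type) (_ : Finite ι)
      (N : ι → ModuleCat.{u} A), (∀ i, Indecomposable (N i)) ∧ Nonempty (M ≃ₗ[A] ∀ i, N i) :=
    fun M hM => ⟨Empty, inferInstance, fun i => i.elim, fun i => i.elim,
      ⟨{ (0 : M →ₗ[A] _) with
        invFun := 0
        left_inv := fun _ => Subsingleton.elim _ _
        right_inv := fun _ => Subsingleton.elim _ _ }⟩⟩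
  induction l with
  | zero =>
    intro M hM
    exact empty M (Module.length_eq_zero_iff.1 (by simpa using hM))
  | succ l ih =>
    intro M hM
    by_cases h0 : Subsingleton M
    · exact empty M h0
    by_cases h : Indecomposable M
    · exact ⟨Unit, inferInstance, fun _ => M, fun _ => h,
        ⟨(LinearEquiv.funUnique Unit A M).symm⟩⟩
    rw [indecomposable_iff_isCompl] at h
    push Not at h
    obtain ⟨K, L, hKL, hK, hL⟩ := h (not_subsingleton_iff_nontrivial.1 h0)
    have hlen : Module.length A M = Module.length A K + Module.length A L := by
      rw [← (Submodule.prodEquivOfIsCompl K L hKL).length_eq, Module.length_prod]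
    have hpos : ∀ S : Submodule A M, S ≠ ⊥ → 1 ≤ Module.length A S := fun S hS => by
      rw [Order.one_le_iff_ne_zero, Ne, Module.length_eq_zero_iff,
        Submodule.subsingleton_iff_eq_bot]
      exact hS
    have aux : ∀ a b : ℕ∞, 1 ≤ b → a + b ≤ (l + 1 : ℕ) → a ≤ l := by
      intro a b hb hab
      have h1 : a + 1 ≤ (l : ℕ∞) + 1 := (add_le_add_right hb a).trans (by exact_mod_cast hab)
      exact (ENat.add_le_add_iff_right ENat.one_ne_top).1 h1
    obtain ⟨ι, _, N, hN, ⟨e⟩⟩ := ih (ModuleCat.of A K)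
      (aux _ _ (hpos L hL) (hlen ▸ hM))
    obtain ⟨ι', _, N', hN', ⟨e'⟩⟩ := ih (ModuleCat.of A L)
      (aux _ _ (hpos K hK) (add_comm (Module.length A K) _ ▸ hlen ▸ hM))
    refine ⟨ι ⊕ ι', inferInstance, Sum.elim N N', fun i => by cases i <;> simp [hN, hN'], ⟨?_⟩⟩
    exact (Submodule.prodEquivOfIsCompl K L hKL).symm ≪≫ₗ (e.prodCongr e') ≪≫ₗ
      (LinearEquiv.sumPiEquivProdPi A ι ι'
        (fun i => ((Sum.elim N N' : ι ⊕ ι' → ModuleCat.{u} A) i : Type u))).symm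

end KrullSchmidt

/-! ### Comparison of short exact sequences and transfer of local endomorphism rings. -/

section Transfer

variable {A : Type u} [Ring A]
variable {M₁ M₂ M₃ N₁ N₂ N₃ : Type u} [AddCommGroup M₁] [Module A M₁] [AddCommGroup M₂]
  [Module A M₂] [AddCommGroup M₃] [Module A M₃] [AddCommGroup N₁] [Module A N₁]
  [AddCommGroup N₂] [Module A N₂] [AddCommGroup N₃] [Module A N₃]
  {i : M₁ →ₗ[A] M₂} {p : M₂ →ₗ[A] M₃} {j : N₁ →ₗ[A] N₂} {q : N₂ →ₗ[A] N₃}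

theorem exists_lift_of_exact (hi : Function.Injective i) (hip : Function.Exact i p)
    (φ : N₁ →ₗ[A] M₂) (h : ∀ x, p (φ x) = 0) : ∃ a : N₁ →ₗ[A] M₁, ∀ x, i (a x) = φ x := by
  let e := LinearEquiv.ofInjective i hi
  refine ⟨e.symm ∘ₗ φ.codRestrict (LinearMap.range i) fun x => (hip _).1 (h x), fun x => ?_⟩
  exact congrArg Subtype.val (e.apply_symm_apply ⟨φ x, (hip _).1 (h x)⟩)

theorem exists_desc_of_exact (hip : Function.Exact i p) (hp : Function.Surjective p)
    (φ : M₂ →ₗ[A] N₁) (h : ∀ x, φ (i x) = 0) : ∃ c : M₃ →ₗ[A] N₁, ∀ x, c (p x) = φ x := by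
  let e := p.quotKerEquivOfSurjective hp
  have hk : LinearMap.ker p ≤ LinearMap.ker φ := fun x hx => by
    obtain ⟨y, rfl⟩ := (hip x).1 hx
    exact h y
  refine ⟨(LinearMap.ker p).liftQ φ hk ∘ₗ e.symm, fun x => ?_⟩
  have : e.symm (p x) = (LinearMap.ker p).mkQ x := by
    rw [LinearEquiv.symm_apply_eq]; rfl
  simp [this]

/-- If the left end of a short exact sequence is a retract of the left end of another one,
compatibly with maps of the middle terms, then the right end, if it has local endomorphism ring,
is a retract of the other right end or of the middle term. -/
theorem isRetractOf_right_or_middle (hip : Function.Exact i p) (hp : Function.Surjective p)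
    (hjq : Function.Exact j q) (hq : Function.Surjective q) [IsLocalRing (Module.End A M₃)]
    (a : M₁ →ₗ[A] N₁) (b : N₁ →ₗ[A] M₁) (hba : ∀ x, b (a x) = x)
    (α : M₂ →ₗ[A] N₂) (hα : ∀ x, α (i x) = j (a x))
    (β : N₂ →ₗ[A] M₂) (hβ : ∀ x, β (j x) = i (b x)) :
    IsRetractOf A M₃ N₃ ∨ IsRetractOf A M₃ M₂ := by
  obtain ⟨γ, hγ⟩ := exists_desc_of_exact hip hp (q ∘ₗ α) fun x => by
    simp [hα, hjq.apply_apply_eq_zero]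
  obtain ⟨δ, hδ⟩ := exists_desc_of_exact hjq hq (p ∘ₗ β) fun x => by
    simp [hβ, hip.apply_apply_eq_zero]
  -- The defect of `β ∘ α` from the identity kills the image of `i`, so it factors through `p`. This
  -- splits the identity of `M₃` into one part through `N₃` and one through `M₂`.
  obtain ⟨h, hh⟩ := exists_desc_of_exact hip hp (LinearMap.id - β ∘ₗ α) fun x => by
    simp [hα, hβ, hba]
  have key : (δ ∘ₗ γ : Module.End A M₃) + p ∘ₗ h = 1 := by
    ext x
    obtain ⟨x, rfl⟩ := hp x
    simp [hγ, hδ, hh]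
  exact (IsLocalRing.isUnit_or_isUnit_of_add_one key).imp .of_isUnit .of_isUnit

/-- The dual of `isRetractOf_right_or_middle`. -/
theorem isRetractOf_left_or_middle (hi : Function.Injective i) (hip : Function.Exact i p)
    (hj : Function.Injective j) (hjq : Function.Exact j q)
    [IsLocalRing (Module.End A M₁)]
    (c : M₃ →ₗ[A] N₃) (d : N₃ →ₗ[A] M₃) (hdc : ∀ x, d (c x) = x)
    (α : M₂ →ₗ[A] N₂) (hα : ∀ x, q (α x) = c (p x))
    (β : N₂ →ₗ[A] M₂) (hβ : ∀ x, p (β x) = d (q x)) :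
    IsRetractOf A M₁ N₁ ∨ IsRetractOf A M₁ M₂ := by
  obtain ⟨γ, hγ⟩ := exists_lift_of_exact hj hjq (α ∘ₗ i) fun x => by
    simp [hα, hip.apply_apply_eq_zero]
  obtain ⟨δ, hδ⟩ := exists_lift_of_exact hi hip (β ∘ₗ j) fun x => by
    simp [hβ, hjq.apply_apply_eq_zero]
  obtain ⟨h, hh⟩ := exists_lift_of_exact hi hip (LinearMap.id - β ∘ₗ α) fun x => by
    simp [hα, hβ, hdc]
  have key : (δ ∘ₗ γ : Module.End A M₁) + h ∘ₗ i = 1 := by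
    ext x
    apply hi
    simp [hγ, hδ, hh]
  exact (IsLocalRing.isUnit_or_isUnit_of_add_one key).imp .of_isUnit .of_isUnit

/-- An endomorphism `f` of `M₃` lifts to `e` on the projective `M₂` and restricts to `a` on `M₁`.
Either `a` or `1 - a` is a unit; by `hmin` the corresponding lift is bijective, and so the
corresponding `f` or `1 - f` is a unit. For an injective envelope `i`, `hmin` is the essentiality of
`i`. -/
theorem isLocalRing_end_right (hi : Function.Injective i) (hip : Function.Exact i p)
    (hp : Function.Surjective p) [Module.Projective A M₂] [IsLocalRing (Module.End A M₁)]
    [Nontrivial M₃]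
    (hmin : ∀ e : M₂ →ₗ[A] M₂, Function.Injective (e ∘ₗ i) → Function.Bijective e) :
    IsLocalRing (Module.End A M₃) := by
  have key : ∀ (f : Module.End A M₃) (e : M₂ →ₗ[A] M₂) (a : Module.End A M₁),
      (∀ x, p (e x) = f (p x)) → (∀ x, i (a x) = e (i x)) → IsUnit a → IsUnit f := by
    intro f e a he ha h
    rw [Module.End.isUnit_iff] at h ⊢
    have hb := hmin e fun x y hxy => h.1 (hi (by rw [ha, ha]; exact hxy))
    refine ⟨(injective_iff_map_eq_zero f).2 fun x hx => ?_, fun y => ?_⟩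
    · obtain ⟨x, rfl⟩ := hp x
      rw [← he] at hx
      obtain ⟨y, hy⟩ := (hip _).1 hx
      obtain ⟨z, rfl⟩ := h.2 y
      rw [ha] at hy
      rw [← hb.1 hy]
      exact hip.apply_apply_eq_zero z
    · obtain ⟨y, rfl⟩ := hp y
      obtain ⟨y, rfl⟩ := hb.2 y
      exact ⟨p y, (he y).symm⟩
  refine .of_isUnit_or_isUnit_one_sub_self fun f => ?_
  obtain ⟨e, he⟩ := Module.projective_lifting_property p (f ∘ₗ p) hp
  replace he : ∀ x, p (e x) = f (p x) := LinearMap.congr_fun he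
  obtain ⟨a, ha⟩ := exists_lift_of_exact hi hip (e ∘ₗ i) fun x => by
    simp [he, hip.apply_apply_eq_zero]
  rcases IsLocalRing.isUnit_or_isUnit_of_add_one (add_sub_cancel (a : Module.End A M₁) 1)
    with h | h
  · exact Or.inl (key f e a he ha h)
  · exact Or.inr (key (1 - f) (LinearMap.id - e) (1 - a) (by simp [he]) (by simp [ha]) h)

/-- Dual argument: extend along `i` to the injective `M₂`, then pass to the quotient `M₃`. For a
projective cover, `hmin` is the superfluity of the kernel. -/
theorem isLocalRing_end_left (hi : Function.Injective i) (hip : Function.Exact i p)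
    (hp : Function.Surjective p) [Module.Injective A M₂] [IsLocalRing (Module.End A M₃)]
    [Nontrivial M₁]
    (hmin : ∀ e : M₂ →ₗ[A] M₂, Function.Surjective (p ∘ₗ e) → Function.Bijective e) :
    IsLocalRing (Module.End A M₁) := by
  have key : ∀ (f : Module.End A M₁) (e : M₂ →ₗ[A] M₂) (c : Module.End A M₃),
      (∀ x, e (i x) = i (f x)) → (∀ x, c (p x) = p (e x)) → IsUnit c → IsUnit f := by
    intro f e c he hc h
    rw [Module.End.isUnit_iff] at h ⊢
    have hb := hmin e fun y => by
      obtain ⟨z, rfl⟩ := h.2 y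
      obtain ⟨z, rfl⟩ := hp z
      exact ⟨z, (hc z).symm⟩
    refine ⟨fun x y hxy => hi (hb.1 (by rw [he, he, hxy])), fun y => ?_⟩
    obtain ⟨x, hx⟩ := hb.2 (i y)
    have hx0 : c (p x) = 0 := by rw [hc, hx, hip.apply_apply_eq_zero]
    obtain ⟨z, rfl⟩ := (hip x).1 (h.1 (hx0.trans (map_zero c).symm))
    exact ⟨z, hi (by rw [← he, hx])⟩
  refine .of_isUnit_or_isUnit_one_sub_self fun f => ?_
  obtain ⟨e, he⟩ := Module.Injective.extension_property A _ _ _ i hi (i ∘ₗ f)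
  replace he : ∀ x, e (i x) = i (f x) := LinearMap.congr_fun he
  obtain ⟨c, hc⟩ := exists_desc_of_exact hip hp (p ∘ₗ e) fun x => by
    simp [he, hip.apply_apply_eq_zero]
  rcases IsLocalRing.isUnit_or_isUnit_of_add_one (add_sub_cancel (c : Module.End A M₃) 1)
    with h | h
  · exact Or.inl (key f e c he hc h)
  · exact Or.inr (key (1 - f) (LinearMap.id - e) (1 - c) (by simp [he]) (by simp [hc]) h)

end Transfer

/-! ### Finite direct sums and the Krull–Schmidt theorem for basic modules. -/

section Sums

variable {A : Type u} [Ring A]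

theorem nonempty_sumOf_equiv_pi {ι : Type u} [Finite ι] (N : ι → ModuleCat.{u} A) :
    Nonempty (sumOf N ≃ₗ[A] ∀ i, N i) := by
  classical
  have := Fintype.ofFinite ι
  exact ⟨DirectSum.linearEquivFunOnFintype A ι fun i => N i⟩

theorem nonempty_prod_sumOf_equiv_pi {ι κ : Type u} [Finite ι] [Finite κ]
    (N : ι → ModuleCat.{u} A) (N' : κ → ModuleCat.{u} A) :
    Nonempty ((sumOf N × sumOf N') ≃ₗ[A] ∀ i, (Sum.elim N N' : ι ⊕ κ → ModuleCat.{u} A) i) := by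
  obtain ⟨e⟩ := nonempty_sumOf_equiv_pi N
  obtain ⟨e'⟩ := nonempty_sumOf_equiv_pi N'
  exact ⟨(e.prodCongr e') ≪≫ₗ (LinearEquiv.sumPiEquivProdPi A ι κ
    (fun i => ((Sum.elim N N' : ι ⊕ κ → ModuleCat.{u} A) i : Type u))).symm⟩

theorem isBasic_of_equiv_pi {ι : Type u} [Finite ι] (N : ι → ModuleCat.{u} A)
    (hN : ∀ i, Indecomposable (N i)) (hne : ∀ i j, Nonempty (N i ≃ₗ[A] N j) → i = j)
    {T : ModuleCat.{u} A} (e : T ≃ₗ[A] ∀ i, N i) : IsBasic T := by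
  obtain ⟨n, ⟨f⟩⟩ := Finite.exists_equiv_fin ι
  refine ⟨n, fun k => N (f.symm k), fun k => hN _, fun k l h => f.symm.injective (hne _ _ h), ⟨?_⟩⟩
  exact e ≪≫ₗ (LinearEquiv.piCongrLeft A (fun i => N i) f.symm).symm

theorem sum_elim_eq_of_equiv {ι κ : Type u}
    {N : ι → ModuleCat.{u} A} {N' : κ → ModuleCat.{u} A}
    (hN : ∀ i j, Nonempty (N i ≃ₗ[A] N j) → i = j)
    (hN' : ∀ i j, Nonempty (N' i ≃ₗ[A] N' j) → i = j)
    (hNN' : ∀ i j, IsEmpty (N i ≃ₗ[A] N' j)) (s t : ι ⊕ κ)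
    (h : Nonempty ((Sum.elim N N' s : ModuleCat.{u} A) ≃ₗ[A] (Sum.elim N N' t : ModuleCat.{u} A))) :
    s = t := by
  obtain ⟨e⟩ := h
  rcases s with i | i <;> rcases t with j | j
  · exact congrArg _ (hN i j ⟨e⟩)
  · exact ((hNN' i j).false e).elim
  · exact ((hNN' j i).false e.symm).elim
  · exact congrArg _ (hN' i j ⟨e⟩)

variable [IsArtinianRing A]

theorem isLocalRing_end_of_finite (M : ModuleCat.{u} A) (hM : Module.Finite A M)
    (h : Indecomposable M) : IsLocalRing (Module.End A M) :=
  isLocalRing_end_of_indecomposable M h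

/-- Sending each summand of a basic decomposition to its isomorphic `Y i` is injective because the
decomposition is multiplicity-free, and surjective because `Y i`, having local endomorphism ring, is
a summand of a single indecomposable factor. Finiteness of the index type comes out of this
bijection. -/
theorem IsBasic.nonempty_equiv_pi {T : ModuleCat.{u} A} [Module.Finite A T] (hT : IsBasic T)
    {ι : Type u} (Y : ι → ModuleCat.{u} A) (hloc : ∀ i, IsLocalRing (Module.End A (Y i)))
    (hne : ∀ i j, Nonempty (Y i ≃ₗ[A] Y j) → i = j)
    (hadd : ∀ i, IsRetractOf A (Y i) T)
    (hall : ∀ N : ModuleCat.{u} A, Indecomposable N → IsRetractOf A N T →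
      ∃ i, Nonempty (N ≃ₗ[A] Y i)) :
    Finite ι ∧ Nonempty (T ≃ₗ[A] ∀ i, Y i) := by
  classical
  obtain ⟨n, N, hN, hNne, ⟨e⟩⟩ := hT
  have hret : ∀ k, IsRetractOf A (N k) T := IsRetractOf.of_equiv_pi e
  choose σ hσ using fun k => hall (N k) (hN k) (hret k)
  have hσi : Function.Injective σ := fun k l hkl => by
    obtain ⟨f⟩ := hσ k
    obtain ⟨g⟩ := hσ l
    rw [← hkl] at g
    exact hNne _ _ ⟨f ≪≫ₗ g.symm⟩
  have hσs : Function.Surjective σ := fun i => by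
    have := hloc i
    obtain ⟨k, hk⟩ := (hadd i).exists_pi e
    have := isLocalRing_end_of_finite (N k) (hret k).finite (hN k)
    have := nontrivial_of_isLocalRing_end (A := A) (M := Y i)
    obtain ⟨f⟩ := hk.nonempty_equiv
    obtain ⟨g⟩ := hσ k
    exact ⟨k, (hne _ _ ⟨f ≪≫ₗ g⟩).symm⟩
  let f := Equiv.ofBijective σ ⟨hσi, hσs⟩
  exact ⟨.of_equiv _ f, ⟨e ≪≫ₗ LinearEquiv.piCongrRight (fun k => (hσ k).some) ≪≫ₗ
    LinearEquiv.piCongrLeft A (fun i => Y i) f⟩⟩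

end Sums

/-! ### Minimality of injective envelopes. -/

section Minimality

variable {A : Type u} [Ring A] [IsArtinianRing A]

/-- The kernel of `e` meets the range of `f` trivially, so essentiality makes `e` injective; on a
module of finite length that suffices. -/
theorem IsInjectiveEnvelope.bijective {M E : ModuleCat.{u} A} {f : M →ₗ[A] E}
    (hf : IsInjectiveEnvelope f) [Module.Finite A E] (e : E →ₗ[A] E)
    (he : Function.Injective (e ∘ₗ f)) : Function.Bijective e := by
  refine IsArtinian.bijective_of_injective_endomorphism e ?_
  rw [← LinearMap.ker_eq_bot]
  refine hf.essential _ (eq_bot_iff.2 ?_)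
  rintro _ ⟨hx, ⟨y, rfl⟩⟩
  have : y = 0 := he (by simpa using hx)
  simp [this]

end Minimality

/-! ### Products of families of maps and exact sequences. -/

section PiMaps

variable {A : Type u} [Ring A] {ι : Type}
  {L M N : ι → Type u} [∀ k, AddCommGroup (L k)] [∀ k, Module A (L k)]
  [∀ k, AddCommGroup (M k)] [∀ k, Module A (M k)] [∀ k, AddCommGroup (N k)] [∀ k, Module A (N k)]

/-- The product of a family of linear maps. -/
def piMap (f : ∀ k, L k →ₗ[A] M k) : (∀ k, L k) →ₗ[A] ∀ k, M k :=
  LinearMap.pi fun k => f k ∘ₗ LinearMap.proj k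

theorem piMap_injective {f : ∀ k, L k →ₗ[A] M k} (hf : ∀ k, Function.Injective (f k)) :
    Function.Injective (piMap f) :=
  fun _ _ h => funext fun k => hf k (congrFun h k)

theorem piMap_surjective {f : ∀ k, L k →ₗ[A] M k} (hf : ∀ k, Function.Surjective (f k)) :
    Function.Surjective (piMap f) := fun y => by
  choose x hx using fun k => hf k (y k)
  exact ⟨x, funext hx⟩

theorem piMap_exact {f : ∀ k, L k →ₗ[A] M k} {g : ∀ k, M k →ₗ[A] N k}
    (h : ∀ k, Function.Exact (f k) (g k)) : Function.Exact (piMap f) (piMap g) := fun y => by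
  refine ⟨fun hy => ?_, ?_⟩
  · choose x hx using fun k => (h k (y k)).1 (congrFun hy k)
    exact ⟨x, funext hx⟩
  · rintro ⟨x, rfl⟩
    exact funext fun k => (h k).apply_apply_eq_zero (x k)

theorem projective_pi {ι : Type*} [Finite ι] {M : ι → Type u} [∀ k, AddCommGroup (M k)]
    [∀ k, Module A (M k)] [∀ k, Module.Projective A (M k)] : Module.Projective A (∀ k, M k) := by
  classical
  have := Fintype.ofFinite ι
  exact Module.Projective.of_equiv (DirectSum.linearEquivFunOnFintype A ι M)

end PiMaps

/-! ### Projective and injective dimension at most one, and vanishing of Ext¹. -/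

section Dimension

variable {A : Type u} [Ring A]

theorem shortExact_of_exact {K P X : ModuleCat.{u} A} {i : K →ₗ[A] P} {p : P →ₗ[A] X}
    (hi : Function.Injective i) (hip : Function.Exact i p) (hp : Function.Surjective p) :
    (ShortComplex.mk (ModuleCat.ofHom i) (ModuleCat.ofHom p)
      (by ext x; exact hip.apply_apply_eq_zero x)).ShortExact :=
  ModuleCat.shortComplex_shortExact _ hip hi hp

theorem projective_iff_object (M : ModuleCat.{u} A) : Module.Projective A M ↔ Projective M :=
  IsProjective.iff_projective M

theorem injective_iff_object (M : ModuleCat.{u} A) : Module.Injective A M ↔ Injective M :=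
  Module.injective_iff_injective_object A M

/-- Dimension shifting. Any epimorphism from a projective will do; later its source is
projective-injective. -/
theorem projectiveDimension_le_one_iff {K P X : ModuleCat.{u} A} {i : K →ₗ[A] P} {p : P →ₗ[A] X}
    (hi : Function.Injective i) (hip : Function.Exact i p) (hp : Function.Surjective p)
    [hP : Module.Projective A P] : projectiveDimension X ≤ 1 ↔ Module.Projective A K := by
  rw [projective_iff_object, projective_iff_hasProjectiveDimensionLT_one]
  exact (projectiveDimension_le_iff X 1).trans
    ((shortExact_of_exact hi hip hp).hasProjectiveDimensionLT_X₃_iff 0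
      ((projective_iff_object P).1 hP))

theorem injectiveDimension_le_one_iff {X E C : ModuleCat.{u} A} {i : X →ₗ[A] E} {p : E →ₗ[A] C}
    (hi : Function.Injective i) (hip : Function.Exact i p) (hp : Function.Surjective p)
    [hE : Module.Injective A E] : injectiveDimension X ≤ 1 ↔ Module.Injective A C := by
  rw [injective_iff_object, injective_iff_hasInjectiveDimensionLT_one]
  exact (injectiveDimension_le_iff X 1).trans
    ((shortExact_of_exact hi hip hp).hasInjectiveDimensionLT_X₃_iff 0
      ((injective_iff_object E).1 hE)).symm

theorem IsRetractOf.nonempty_retract {M N : ModuleCat.{u} A} (h : IsRetractOf A M N) :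
    Nonempty (Retract M N) := by
  obtain ⟨s, r, h⟩ := h
  exact ⟨⟨ModuleCat.ofHom s, ModuleCat.ofHom r, by ext x; exact h x⟩⟩

theorem IsRetractOf.projectiveDimension_le {M N : ModuleCat.{u} A} (h : IsRetractOf A M N) :
    projectiveDimension M ≤ projectiveDimension N :=
  h.nonempty_retract.some.projectiveDimension_le

theorem IsRetractOf.injectiveDimension_le {M N : ModuleCat.{u} A} (h : IsRetractOf A M N) :
    injectiveDimension M ≤ injectiveDimension N :=
  h.nonempty_retract.some.injectiveDimension_le

theorem projectiveDimension_le_zero_iff (M : ModuleCat.{u} A) :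
    projectiveDimension M ≤ 0 ↔ Module.Projective A M := by
  rw [projective_iff_object, projective_iff_hasProjectiveDimensionLE_zero]
  exact projectiveDimension_le_iff M 0

theorem projectiveDimension_eq_one_iff (M : ModuleCat.{u} A) :
    projectiveDimension M = 1 ↔ projectiveDimension M ≤ 1 ∧ ¬ Module.Projective A M := by
  rw [le_antisymm_iff, ← projectiveDimension_le_zero_iff]
  exact and_congr_right fun _ =>
    (projectiveDimension_ge_iff M 1).trans (not_congr (projectiveDimension_le_iff M 0).symm)

/-- The canonical presentations by free modules on all elements have projective kernels, and their
product is again such a presentation. -/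
theorem projectiveDimension_pi_le_one {ι : Type} [Finite ι] (M : ι → ModuleCat.{u} A)
    (h : ∀ k, projectiveDimension (M k) ≤ 1) :
    projectiveDimension (ModuleCat.of A (∀ k, M k)) ≤ 1 := by
  have key : ∀ k, Module.Projective A
      (LinearMap.ker (Finsupp.linearCombination A (id : M k → M k))) := fun k =>
    (projectiveDimension_le_one_iff (K := ModuleCat.of A (LinearMap.ker _))
      (P := ModuleCat.of A (M k →₀ A)) (LinearMap.ker _).injective_subtype
      (LinearMap.exact_subtype_ker_map _) (Finsupp.linearCombination_id_surjective A (M k))).1 (h k)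
  have := projective_pi (A := A) (M := fun k => M k →₀ A)
  exact (projectiveDimension_le_one_iff (K := ModuleCat.of A (∀ k, LinearMap.ker _))
    (P := ModuleCat.of A (∀ k, M k →₀ A)) (X := ModuleCat.of A (∀ k, M k))
    (piMap_injective fun k => (LinearMap.ker _).injective_subtype)
    (piMap_exact fun k => LinearMap.exact_subtype_ker_map _)
    (piMap_surjective fun k => Finsupp.linearCombination_id_surjective A (M k))).2 projective_pi

/-- In the long exact sequence, Ext¹(T, M) lies between Ext¹(T, G), zero because `G` is injective,
and Ext² of `T` with the kernel of `g`, zero because pd T ≤ 1. -/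
theorem subsingleton_ext_one {T M G : ModuleCat.{u} A} (hT : projectiveDimension T ≤ 1)
    [hG : Module.Injective A G] (g : G →ₗ[A] M) (hg : Function.Surjective g) :
    Subsingleton (Abelian.Ext T M 1) := by
  have hS := shortExact_of_exact (K := ModuleCat.of A (LinearMap.ker g))
    (LinearMap.ker g).injective_subtype (LinearMap.exact_subtype_ker_map g) hg
  have : Injective G := (injective_iff_object G).1 hG
  have : HasProjectiveDimensionLT T 2 := (projectiveDimension_le_iff T 1).1 hT
  refine subsingleton_of_forall_eq 0 fun x => ?_
  obtain ⟨y, rfl⟩ := Abelian.Ext.covariant_sequence_exact₃ T hS x (n₁ := 2) rfl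
    (Abelian.Ext.eq_zero_of_hasProjectiveDimensionLT _ 2 le_rfl)
  rw [Abelian.Ext.eq_zero_of_injective (I := G) y, Abelian.Ext.zero_comp]

end Dimension

/-! ### Modules generated or cogenerated by projective-injectives. -/

section ProjInj

variable {A : Type u} [Ring A]

/-- Finitely generated projective-injective modules. -/
structure IsProjInj (G : ModuleCat.{u} A) : Prop where
  finite : Module.Finite A G
  projective : Module.Projective A G
  injective : Module.Injective A G

theorem IsProjInj.pow {G : ModuleCat.{u} A} (hG : IsProjInj G) (m : ℕ) :
    IsProjInj (ModuleCat.of A (Fin m → G)) := by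
  obtain ⟨_, _, _⟩ := hG
  exact ⟨inferInstanceAs (Module.Finite A (Fin m → G)),
    projective_pi (A := A) (M := fun _ : Fin m => G),
    inferInstanceAs (Module.Injective A (Fin m → G))⟩

/-- `M` is a quotient of a finitely generated projective-injective module. -/
def IsProjInjGenerated (M : ModuleCat.{u} A) : Prop :=
  ∃ (G : ModuleCat.{u} A) (g : G →ₗ[A] M), IsProjInj G ∧ Function.Surjective g

/-- `M` is a submodule of a finitely generated projective-injective module. -/
def IsProjInjCogenerated (M : ModuleCat.{u} A) : Prop :=
  ∃ (G : ModuleCat.{u} A) (g : M →ₗ[A] G), IsProjInj G ∧ Function.Injective g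

theorem IsProjInjGenerated.of_surjective {M N : ModuleCat.{u} A} (h : IsProjInjGenerated M)
    (f : M →ₗ[A] N) (hf : Function.Surjective f) : IsProjInjGenerated N := by
  obtain ⟨G, g, hG, hg⟩ := h
  exact ⟨G, f ∘ₗ g, hG, hf.comp hg⟩

theorem IsProjInjCogenerated.of_injective {M N : ModuleCat.{u} A} (h : IsProjInjCogenerated N)
    (f : M →ₗ[A] N) (hf : Function.Injective f) : IsProjInjCogenerated M := by
  obtain ⟨G, g, hG, hg⟩ := h
  exact ⟨G, g ∘ₗ f, hG, hg.comp hf⟩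

theorem IsProjInjGenerated.pow {M : ModuleCat.{u} A} (h : IsProjInjGenerated M) (m : ℕ) :
    IsProjInjGenerated (ModuleCat.of A (Fin m → M)) := by
  obtain ⟨G, g, hG, hg⟩ := h
  exact ⟨_, piMap fun _ => g, hG.pow m, piMap_surjective fun _ => hg⟩

theorem IsProjInjCogenerated.pow {M : ModuleCat.{u} A} (h : IsProjInjCogenerated M) (m : ℕ) :
    IsProjInjCogenerated (ModuleCat.of A (Fin m → M)) := by
  obtain ⟨G, g, hG, hg⟩ := h
  exact ⟨_, piMap fun _ => g, hG.pow m, piMap_injective fun _ => hg⟩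

theorem IsInC.isProjInjGenerated {Q M : ModuleCat.{u} A} (hQ : IsProjInj Q) (hM : IsInC Q M) :
    IsProjInjGenerated M := by
  obtain ⟨m, f, hf⟩ := hM.gen
  exact ⟨_, f, hQ.pow m, hf⟩

theorem IsInC.isProjInjCogenerated {Q M : ModuleCat.{u} A} (hQ : IsProjInj Q) (hM : IsInC Q M) :
    IsProjInjCogenerated M := by
  obtain ⟨m, f, hf⟩ := hM.cogen
  exact ⟨_, f, hQ.pow m, hf⟩

theorem IsInC.of_isRetractOf {Q M T : ModuleCat.{u} A} (hT : IsInC Q T)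
    (h : IsRetractOf A M T) : IsInC Q M := by
  have := hT.finite
  refine ⟨h.finite, ?_, ?_⟩
  · obtain ⟨s, r, h⟩ := h
    obtain ⟨m, f, hf⟩ := hT.gen
    exact ⟨m, r ∘ₗ f, (Function.LeftInverse.surjective h).comp hf⟩
  · obtain ⟨s, r, h⟩ := h
    obtain ⟨m, f, hf⟩ := hT.cogen
    exact ⟨m, f ∘ₗ s, hf.comp (Function.LeftInverse.injective h)⟩

theorem IsInAdd.exists_isRetractOf {X M : ModuleCat.{u} A} (h : IsInAdd X M) :
    ∃ m : ℕ, IsRetractOf A M (Fin m → X) := by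
  obtain ⟨m, N, ⟨e⟩⟩ := h
  exact ⟨m, e.toLinearMap ∘ₗ LinearMap.inl A M N, LinearMap.fst A M N ∘ₗ e.symm.toLinearMap,
    fun x => by simp⟩

theorem IsInAdd.isProjInjGenerated {T M : ModuleCat.{u} A} (h : IsInAdd T M)
    (hT : IsProjInjGenerated T) : IsProjInjGenerated M := by
  obtain ⟨m, s, r, h⟩ := h.exists_isRetractOf
  exact (hT.pow m).of_surjective r (Function.LeftInverse.surjective h)

theorem IsInAdd.isProjInjCogenerated {T M : ModuleCat.{u} A} (h : IsInAdd T M)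
    (hT : IsProjInjCogenerated T) : IsProjInjCogenerated M := by
  obtain ⟨m, s, r, h⟩ := h.exists_isRetractOf
  exact (hT.pow m).of_injective s (Function.LeftInverse.injective h)

/-- A summand with local endomorphism ring of a power of a module in `add T` is a summand
of `T`. -/
theorem IsInAdd.isRetractOf_of_pow {T M X : ModuleCat.{u} A} (h : IsInAdd T M)
    [IsLocalRing (Module.End A X)] {n : ℕ} (hX : IsRetractOf A X (Fin n → M)) :
    IsRetractOf A X T := by
  obtain ⟨m, hm⟩ := h.exists_isRetractOf
  obtain ⟨-, h1⟩ := hX.exists_pi (LinearEquiv.refl A _)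
  obtain ⟨-, h2⟩ := (h1.trans hm).exists_pi (LinearEquiv.refl A _)
  exact h2

theorem isRetractOf_middle_of_projective {K P X : Type u} [AddCommGroup K] [Module A K]
    [AddCommGroup P] [Module A P] [AddCommGroup X] [Module A X] {i : K →ₗ[A] P} {p : P →ₗ[A] X}
    (hi : Function.Injective i) (hip : Function.Exact i p) (hp : Function.Surjective p)
    [Module.Projective A X] : IsRetractOf A K P := by
  obtain ⟨s, hs⟩ := Module.projective_lifting_property p LinearMap.id hp
  obtain ⟨r, hr⟩ := exists_lift_of_exact hi hip (LinearMap.id - s ∘ₗ p) fun x => by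
    simpa [sub_eq_zero] using (LinearMap.congr_fun hs (p x)).symm
  exact ⟨i, r, fun x => hi (by simp [hr, hip.apply_apply_eq_zero])⟩

theorem isRetractOf_middle_of_injective {K P X : Type u} [AddCommGroup K] [Module A K]
    [AddCommGroup P] [Module A P] [AddCommGroup X] [Module A X] {i : K →ₗ[A] P} {p : P →ₗ[A] X}
    (hi : Function.Injective i) (hip : Function.Exact i p) (hp : Function.Surjective p)
    [hK : Module.Injective A K] : IsRetractOf A X P := by
  obtain ⟨r, hr⟩ := hK.out i hi LinearMap.id
  obtain ⟨s, hs⟩ := exists_desc_of_exact hip hp (LinearMap.id - i ∘ₗ r) fun x => by simp [hr]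
  refine ⟨s, p, fun x => ?_⟩
  obtain ⟨x, rfl⟩ := hp x
  simp [hs, hip.apply_apply_eq_zero]

end ProjInj

/-! ### Cosyzygies of indecomposable projective non-injective modules. -/

section Cosyzygy

variable {A : Type u} [Ring A]

theorem IsCosyzygy.of_equiv {M N C : ModuleCat.{u} A} (e : M ≃ₗ[A] N) (h : IsCosyzygy N C) :
    IsCosyzygy M C := by
  obtain ⟨E, f, hf, ⟨e'⟩⟩ := h
  have hr : LinearMap.range (f ∘ₗ e.toLinearMap) = LinearMap.range f := by
    rw [LinearMap.range_comp, LinearEquiv.range, Submodule.map_top]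
  refine ⟨E, f ∘ₗ e, ⟨hf.injective_module, hf.mono.comp e.injective, fun K hK => ?_⟩, ⟨?_⟩⟩
  · exact hf.essential K (hr ▸ hK)
  · exact e' ≪≫ₗ Submodule.quotEquivOfEq _ _ hr.symm

theorem IsCosyzygy.exists_exact {M C : ModuleCat.{u} A} (h : IsCosyzygy M C) :
    ∃ (E : ModuleCat.{u} A) (f : M →ₗ[A] E) (p : E →ₗ[A] C), IsInjectiveEnvelope f ∧
      Function.Exact f p ∧ Function.Surjective p := by
  obtain ⟨E, f, hf, ⟨e⟩⟩ := h
  refine ⟨E, f, e.symm.toLinearMap ∘ₗ (LinearMap.range f).mkQ, hf, fun x => ?_,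
    e.symm.surjective.comp (Submodule.mkQ_surjective _)⟩
  simp

theorem exists_isCosyzygy (M : ModuleCat.{u} A) : ∃ C, IsCosyzygy M C := by
  obtain ⟨E, f, hf⟩ := exists_injectiveEnvelope M
  exact ⟨ModuleCat.of A (E ⧸ LinearMap.range f), E, f, hf, ⟨LinearEquiv.refl A _⟩⟩

theorem IsCosyzygy.subsingleton {M C : ModuleCat.{u} A} (h : IsCosyzygy M C)
    [Module.Injective A M] : Subsingleton C := by
  obtain ⟨E, f, p, hf, hfp, hp⟩ := h.exists_exact
  obtain ⟨r, hr⟩ := Module.Injective.out f hf.mono (LinearMap.id (R := A) (M := M))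
  have hk : LinearMap.ker r = ⊥ := hf.essential _ (eq_bot_iff.2 (by
    rintro _ ⟨hx, ⟨y, rfl⟩⟩
    have : y = 0 := (hr y).symm.trans hx
    simp [this]))
  refine subsingleton_of_forall_eq 0 fun x => ?_
  obtain ⟨x, rfl⟩ := hp x
  have : x = f (r x) := LinearMap.ker_eq_bot.1 hk (hr _).symm
  rw [this, hfp.apply_apply_eq_zero]

/-- An embedding of `M` in a projective-injective `G` extends to the envelope, injectively by
essentiality. So the envelope is a summand of `G`, hence finitely generated and projective. -/
theorem IsCosyzygy.exists_isProjInj [IsArtinianRing A] {M C : ModuleCat.{u} A}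
    (h : IsCosyzygy M C) (hM : IsProjInjCogenerated M) :
    ∃ (E : ModuleCat.{u} A) (f : M →ₗ[A] E) (p : E →ₗ[A] C), IsProjInj E ∧
      IsInjectiveEnvelope f ∧ Function.Exact f p ∧ Function.Surjective p := by
  obtain ⟨E, f, p, hf, hfp, hp⟩ := h.exists_exact
  obtain ⟨G, g, ⟨_, _, hGi⟩, hg⟩ := hM
  obtain ⟨k, hk⟩ := hGi.out f hf.mono g
  have hki : Function.Injective k := by
    rw [← LinearMap.ker_eq_bot]
    refine hf.essential _ (eq_bot_iff.2 ?_)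
    rintro _ ⟨hx, ⟨y, rfl⟩⟩
    have : y = 0 := hg (by rw [← hk, map_zero]; exact hx)
    simp [this]
  have := hf.injective_module
  have hE := IsRetractOf.of_injective k hki
  exact ⟨E, f, p, ⟨hE.finite, hE.projective, this⟩, hf, hfp, hp⟩

variable [IsArtinianRing A] {P C : ModuleCat.{u} A} (hP : IsIndecProjNonInj P)
  (hC : IsCosyzygy P C) (hPc : IsProjInjCogenerated P)

include hP hC hPc

theorem IsCosyzygy.not_projective : ¬ Module.Projective A C := by
  intro h
  obtain ⟨E, f, p, ⟨_, _, _⟩, hf, hfp, hp⟩ := hC.exists_isProjInj hPc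
  exact hP.2.2.2 (isRetractOf_middle_of_projective hf.mono hfp hp).injective

theorem IsCosyzygy.isLocalRing_end : IsLocalRing (Module.End A C) := by
  have hnp := hC.not_projective hP hPc
  obtain ⟨E, f, p, ⟨_, _, _⟩, hf, hfp, hp⟩ := hC.exists_isProjInj hPc
  have : Nontrivial C := by
    rw [← not_subsingleton_iff_nontrivial]
    exact fun _ => hnp Module.Projective.of_free
  have := isLocalRing_end_of_finite P hP.1 hP.2.1
  exact isLocalRing_end_right hf.mono hfp hp hf.bijective

/-- Both envelopes are projective, so an isomorphism of cosyzygies lifts in both directions. Then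
`P` is a summand of `P'` or of its own envelope, and the latter would make it injective. -/
theorem IsCosyzygy.nonempty_equiv {P' C' : ModuleCat.{u} A} (hP' : IsIndecProjNonInj P')
    (hC' : IsCosyzygy P' C') (hPc' : IsProjInjCogenerated P') (e : C ≃ₗ[A] C') :
    Nonempty (P ≃ₗ[A] P') := by
  obtain ⟨E, f, p, ⟨_, _, _⟩, hf, hfp, hp⟩ := hC.exists_isProjInj hPc
  obtain ⟨E', f', p', ⟨_, _, _⟩, hf', hfp', hp'⟩ := hC'.exists_isProjInj hPc'
  have := isLocalRing_end_of_finite P hP.1 hP.2.1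
  have := isLocalRing_end_of_finite P' hP'.1 hP'.2.1
  have := nontrivial_of_isLocalRing_end (A := A) (M := P)
  obtain ⟨α, hα⟩ := Module.projective_lifting_property p' (e.toLinearMap ∘ₗ p) hp'
  obtain ⟨β, hβ⟩ := Module.projective_lifting_property p (e.symm.toLinearMap ∘ₗ p') hp
  rcases isRetractOf_left_or_middle hf.mono hfp hf'.mono hfp' e.toLinearMap e.symm.toLinearMap
    (by simp) α (LinearMap.congr_fun hα) β (LinearMap.congr_fun hβ) with h | h
  · exact h.nonempty_equiv
  · exact absurd h.injective hP.2.2.2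

omit hPc in
/-- The cosyzygy of an indecomposable projective non-injective module is a summand of every
tilting module in `𝒞`. -/
theorem IsTilting.isRetractOf_cosyzygy {T : ModuleCat.{u} A} (hT : IsTilting T)
    (hTg : IsProjInjGenerated T) (hTc : IsProjInjCogenerated T) :
    IsProjInjCogenerated P ∧ IsRetractOf A C T := by
  obtain ⟨T₀, T₁, f, g, hT₀, hT₁, hf, hfg, hg⟩ := hT.exists_coresolution
  obtain ⟨_, hPi, _, hPni⟩ := id hP
  obtain ⟨n, k, hk⟩ := Module.Finite.exists_fin' A P
  obtain ⟨s, r, hsr⟩ := IsRetractOf.of_surjective k hk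
  let F : (Fin n → A) →ₗ[A] Fin n → T₀ := piMap fun _ => f
  have hF : Function.Injective F := piMap_injective fun _ => hf
  have hPc : IsProjInjCogenerated P := ((hT₀.isProjInjCogenerated hTc).pow n).of_injective
    (F ∘ₗ s) (hF.comp (Function.LeftInverse.injective hsr))
  refine ⟨hPc, ?_⟩
  have hloc := hC.isLocalRing_end hP hPc
  have hnp := hC.not_projective hP hPc
  obtain ⟨E, i, p, ⟨_, _, hEi⟩, hi, hip, hp⟩ := hC.exists_isProjInj hPc
  -- The power of `T₀` need not be injective, so the map from `P` is first lifted to a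
  -- projective-injective `G` above it and then extended from `P` to `E`.
  obtain ⟨G, h, ⟨_, _, hGi⟩, hh⟩ := (hT₀.isProjInjGenerated hTg).pow n
  obtain ⟨l, hl⟩ := Module.projective_lifting_property h (F ∘ₗ s) hh
  obtain ⟨α, hα⟩ := hGi.out i hi.mono l
  obtain ⟨β, hβ⟩ := hEi.out F hF (i ∘ₗ r)
  rcases isRetractOf_right_or_middle hip hp (piMap_exact fun _ : Fin n => hfg)
    (piMap_surjective fun _ => hg) s r hsr (h ∘ₗ α)
    (fun x => by simpa [hα] using LinearMap.congr_fun hl x) β hβ with h | h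
  · exact hT₁.isRetractOf_of_pow h
  · exact absurd h.projective hnp

end Cosyzygy

/-! ### Modules in 𝒞 of projective dimension one. -/

section PdOne

variable {A : Type u} [Ring A] [IsArtinianRing A]

/-- Every indecomposable module in `𝒞` of projective dimension one is the cosyzygy of an
indecomposable projective non-injective module. -/
theorem IsIndecInCOfPdOne.exists_equiv_cosyzygy {Q X : ModuleCat.{u} A}
    (hX : IsIndecInCOfPdOne Q X) (hQ : IsProjInj Q)
    {ι : Type u} {P : ι → ModuleCat.{u} A} (hP : IsRepresentatives IsIndecProjNonInj P)
    {C : ι → ModuleCat.{u} A} (hC : ∀ j, IsCosyzygy (P j) (C j)) :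
    ∃ j, Nonempty (X ≃ₗ[A] C j) := by
  obtain ⟨hXi, hXC, hXpd⟩ := hX
  obtain ⟨hpd, hnp⟩ := (projectiveDimension_eq_one_iff X).1 hXpd
  have := hXC.finite
  have := isLocalRing_end_of_finite X hXC.finite hXi
  have := nontrivial_of_isLocalRing_end (A := A) (M := X)
  obtain ⟨G, g, ⟨_, _, hGi⟩, hg⟩ := hXC.isProjInjGenerated hQ
  let K := ModuleCat.of A (LinearMap.ker g)
  have hKi := (LinearMap.ker g).injective_subtype
  have : Module.Projective A K := (projectiveDimension_le_one_iff (K := K) hKi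
    (LinearMap.exact_subtype_ker_map g) hg).1 hpd
  have : Module.Finite A K := inferInstanceAs (Module.Finite A (LinearMap.ker g))
  obtain ⟨κ, _, N, hN, ⟨e⟩⟩ := exists_indecomposable_decomposition K
  have hret : ∀ k, IsRetractOf A (N k) K := IsRetractOf.of_equiv_pi e
  -- Injective summands of `K` have zero cosyzygy; each other summand is isomorphic to a listed `P
  -- j`, so the given `C j` serves as its cosyzygy.
  have hcos : ∀ k, ∃ D, IsCosyzygy (N k) D ∧
      (Subsingleton D ∨ ∃ j, D = C j ∧ Nonempty (N k ≃ₗ[A] P j)) := by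
    intro k
    by_cases hi : Module.Injective A (N k)
    · obtain ⟨D, hD⟩ := exists_isCosyzygy (N k)
      exact ⟨D, hD, Or.inl hD.subsingleton⟩
    · obtain ⟨j, ⟨f⟩⟩ := hP.exists_iso (N k) ⟨(hret k).finite, hN k, (hret k).projective, hi⟩
      exact ⟨C j, (hC j).of_equiv f, Or.inr ⟨j, rfl, ⟨f⟩⟩⟩
  choose D hD hDC using hcos
  choose E i p hi hip hp using fun k => (hD k).exists_exact
  have : ∀ k, Module.Injective A (E k) := fun k => (hi k).injective_module
  have hii : Function.Injective (piMap i) := piMap_injective fun k => (hi k).mono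
  obtain ⟨α, hα⟩ := Module.Injective.out (LinearMap.ker g).subtype hKi
    (piMap i ∘ₗ e.toLinearMap)
  obtain ⟨β, hβ⟩ := hGi.out (piMap i) hii ((LinearMap.ker g).subtype ∘ₗ e.symm.toLinearMap)
  rcases isRetractOf_right_or_middle (LinearMap.exact_subtype_ker_map g) hg
    (piMap_exact hip) (piMap_surjective hp) e.toLinearMap e.symm.toLinearMap
    (by simp) α hα β hβ with h | h
  · obtain ⟨k, hk⟩ := h.exists_pi (LinearEquiv.refl A _)
    rcases hDC k with h0 | ⟨j, hj, ⟨f⟩⟩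
    · obtain ⟨s, r, hsr⟩ := hk
      have := (Function.LeftInverse.injective hsr).subsingleton
      exact (not_subsingleton X this).elim
    · rw [hj] at hk
      have hPc : IsProjInjCogenerated (P j) := by
        obtain ⟨s, r, hsr⟩ := hret k
        exact ⟨G, (LinearMap.ker g).subtype ∘ₗ s ∘ₗ f.symm.toLinearMap, ⟨‹_›, ‹_›, ‹_›⟩,
          hKi.comp ((Function.LeftInverse.injective hsr).comp f.symm.injective)⟩
      have := (hC j).isLocalRing_end (hP.prop j) hPc
      exact ⟨j, hk.nonempty_equiv⟩
  · exact absurd h.projective hnp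

end PdOne

/-! ### The duality module cogenerates all finitely generated modules. -/

section Dual

/-- The cyclic module generated by `m` has a simple quotient `R ⧸ I`. As `I` contains the radical
and `R ⧸ rad R` is semisimple, this quotient embeds in `R ⧸ rad R` and so in the injective dualizing
module; the resulting map extends to `M`. -/
theorem exists_dualizingModule_apply_ne_zero (R : Type u) [CommRing R] [IsArtinianRing R]
    {M : Type u} [AddCommGroup M] [Module R M] {m : M} (hm : m ≠ 0) :
    ∃ φ : M →ₗ[R] dualizingModule R, φ m ≠ 0 := by
  obtain ⟨j, hj⟩ := (exists_injectiveEnvelope (ModuleCat.of R (R ⧸ Ring.jacobson R))).choose_spec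
  have : IsSemisimpleModule R (R ⧸ Ring.jacobson R) :=
    (IsArtinian.isSemisimpleModule_iff_jacobson R _).2 (Module.jacobson_quotient_jacobson R R)
  let s : R →ₗ[R] M := LinearMap.toSpanSingleton R M m
  have hne : LinearMap.ker s ≠ ⊤ := fun h => hm (by
    have : (1 : R) ∈ LinearMap.ker s := h ▸ Submodule.mem_top
    simpa [s] using this)
  obtain ⟨I, hI, hle⟩ := Ideal.exists_le_maximal (LinearMap.ker s) hne
  have hjac : Ring.jacobson R ≤ I := Ring.jacobson_le_of_isMaximal I
  obtain ⟨t, ht⟩ := IsSemisimpleModule.lifting_property (Submodule.factor hjac)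
    (Submodule.factor_surjective hjac) LinearMap.id
  let k : R ⧸ LinearMap.ker s →ₗ[R] M := (LinearMap.ker s).liftQ s le_rfl
  have hk : Function.Injective k := by
    rw [← LinearMap.ker_eq_bot]
    exact Submodule.ker_liftQ_eq_bot _ _ _ le_rfl
  obtain ⟨φ, hφ⟩ := hj.injective_module.out k hk (j ∘ₗ t ∘ₗ Submodule.factor hle)
  refine ⟨φ, fun h0 => ?_⟩
  have h1 : k ((LinearMap.ker s).mkQ 1) = m :=
    (Submodule.liftQ_apply _ _ _).trans (one_smul R m)
  have h2 := hφ ((LinearMap.ker s).mkQ 1)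
  have h3 : t (Submodule.factor hle ((LinearMap.ker s).mkQ 1)) = 0 :=
    hj.mono ((h2.symm.trans ((congrArg φ h1).trans h0)).trans (map_zero j).symm)
  have h4 := LinearMap.congr_fun ht (Submodule.factor hle ((LinearMap.ker s).mkQ 1))
  rw [LinearMap.comp_apply, h3, map_zero] at h4
  exact (Ideal.ne_top_iff_one I).1 hI.ne_top ((Submodule.Quotient.mk_eq_zero I).1 h4.symm)

variable (R : Type u) [CommRing R] [IsArtinianRing R] {A : Type u} [Ring A] [Algebra R A]

/-- Hom-tensor adjunction: an `R`-linear functional `φ` on `M` gives the `A`-linear map `x ↦ (a ↦ φ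
(a • x))`, whose value at `a = 1` recovers `φ`. -/
theorem exists_dualRegular_apply_ne_zero {M : Type u} [AddCommGroup M] [Module A M] {m : M}
    (hm : m ≠ 0) : ∃ φ : M →ₗ[A] DualRegular R A, φ m ≠ 0 := by
  let _ : Module R M := Module.compHom M (algebraMap R A)
  have : IsScalarTower R A M := ⟨fun r a x => by
    rw [Algebra.smul_def, mul_smul]; rfl⟩
  obtain ⟨φ, hφ⟩ := exists_dualizingModule_apply_ne_zero R hm
  let Φ (x : M) : A →ₗ[R] dualizingModule R :=
    φ ∘ₗ (LinearMap.toSpanSingleton A M x).restrictScalars R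
  have hΦ : ∀ x a, Φ x a = φ (a • x) := fun x a => rfl
  let F : M →ₗ[A] DualRegular R A :=
    { toFun := Φ
      map_add' := fun x y => LinearMap.ext fun a => by
        rw [hΦ, smul_add, map_add]; rfl
      map_smul' := fun b x => LinearMap.ext fun a => by
        rw [hΦ, smul_smul]; rfl }
  refine ⟨F, fun h => hφ ?_⟩
  have : Φ m 1 = 0 := LinearMap.congr_fun (show Φ m = 0 from h) 1
  rwa [hΦ, one_smul] at this

/-- Choose a map to a power of the dual with minimal kernel. A nonzero kernel element would be
detected by one more functional, which would shrink the kernel. -/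
theorem exists_injective_dualRegular [Module.Finite R A] (M : Type u) [AddCommGroup M]
    [Module A M] [Module.Finite A M] :
    ∃ (n : ℕ) (f : M →ₗ[A] Fin n → DualRegular R A), Function.Injective f := by
  have : IsArtinianRing A := .of_finite R A
  obtain ⟨S, ⟨n, f, rfl⟩, hmin⟩ := IsArtinian.set_has_minimal (R := A) (M := M)
    {S : Submodule A M | ∃ (n : ℕ) (f : M →ₗ[A] Fin n → DualRegular R A), S = LinearMap.ker f}
    ⟨_, 0, (0 : M →ₗ[A] Fin 0 → DualRegular R A), rfl⟩
  refine ⟨n, f, (injective_iff_map_eq_zero f).2 fun m hm => ?_⟩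
  by_contra h0
  obtain ⟨φ, hφ⟩ := exists_dualRegular_apply_ne_zero R (A := A) h0
  let g : M →ₗ[A] Fin (n + 1) → DualRegular R A :=
    LinearMap.pi (Fin.cons φ fun k => LinearMap.proj k ∘ₗ f)
  have hg : ∀ x, g x = 0 → φ x = 0 ∧ f x = 0 := fun x hx =>
    ⟨congrFun hx 0, funext fun k => congrFun hx k.succ⟩
  refine hmin (LinearMap.ker g) ⟨_, g, rfl⟩ (lt_of_le_of_ne (fun x hx => (hg x hx).2) fun h => ?_)
  have : m ∈ LinearMap.ker g := h ▸ hm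
  exact hφ (hg m this).1

end Dual

/-! ### Syzygies of indecomposable injective non-projective modules. -/

section Syzygy

variable {A : Type u} [Ring A]

theorem IsSyzygy.of_equiv {M N K : ModuleCat.{u} A} (e : M ≃ₗ[A] N) (h : IsSyzygy N K) :
    IsSyzygy M K := by
  obtain ⟨P, f, hf, ⟨e'⟩⟩ := h
  have hk : LinearMap.ker (e.symm.toLinearMap ∘ₗ f) = LinearMap.ker f := by
    ext x; simp
  refine ⟨P, e.symm.toLinearMap ∘ₗ f, ⟨hf.projective_module, e.symm.surjective.comp hf.epi,
    fun L hL => hf.superfluous L (hk ▸ hL)⟩, ⟨e' ≪≫ₗ LinearEquiv.ofEq _ _ hk.symm⟩⟩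

theorem IsSyzygy.exists_exact {M K : ModuleCat.{u} A} (h : IsSyzygy M K) :
    ∃ (P : ModuleCat.{u} A) (i : K →ₗ[A] P) (f : P →ₗ[A] M), IsProjectiveCover f ∧
      Function.Injective i ∧ Function.Exact i f := by
  obtain ⟨P, f, hf, ⟨e⟩⟩ := h
  refine ⟨P, (LinearMap.ker f).subtype ∘ₗ e.toLinearMap, f, hf,
    (LinearMap.ker f).injective_subtype.comp e.injective, fun x => ⟨fun hx => ?_, ?_⟩⟩
  · exact ⟨e.symm ⟨x, hx⟩, by simp⟩
  · rintro ⟨y, rfl⟩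
    exact (e y).2

theorem IsProjectiveCover.surjective_of_comp {P M G : ModuleCat.{u} A} {f : P →ₗ[A] M}
    (hf : IsProjectiveCover f) (k : G →ₗ[A] P) (hk : Function.Surjective (f ∘ₗ k)) :
    Function.Surjective k := by
  rw [← LinearMap.range_eq_top]
  refine hf.superfluous _ (eq_top_iff.2 fun x _ => ?_)
  obtain ⟨y, hy⟩ := hk (f x)
  refine Submodule.mem_sup.2 ⟨k y, ⟨y, rfl⟩, x - k y, ?_, by simp⟩
  simp only [LinearMap.mem_ker, map_sub]
  exact sub_eq_zero.2 hy.symm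

theorem IsProjectiveCover.bijective [IsArtinianRing A] {P M : ModuleCat.{u} A} {f : P →ₗ[A] M}
    (hf : IsProjectiveCover f) [Module.Finite A P] (e : P →ₗ[A] P)
    (he : Function.Surjective (f ∘ₗ e)) : Function.Bijective e :=
  IsNoetherian.bijective_of_surjective_endomorphism e (hf.surjective_of_comp e he)

theorem exists_isSyzygy [IsArtinianRing A] (M : ModuleCat.{u} A) [Module.Finite A M] :
    ∃ K, IsSyzygy M K := by
  obtain ⟨P, f, -, hf⟩ := exists_projectiveCover M
  exact ⟨ModuleCat.of A (LinearMap.ker f), P, f, hf, ⟨LinearEquiv.refl A _⟩⟩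

theorem IsSyzygy.subsingleton {M K : ModuleCat.{u} A} (h : IsSyzygy M K)
    [Module.Projective A M] : Subsingleton K := by
  obtain ⟨P, i, f, hf, hi, hif⟩ := h.exists_exact
  obtain ⟨s, hs⟩ := Module.projective_lifting_property f LinearMap.id hf.epi
  have hs' := hf.surjective_of_comp s fun x => ⟨x, LinearMap.congr_fun hs x⟩
  refine subsingleton_of_forall_eq 0 fun x => hi ?_
  obtain ⟨y, hy⟩ := hs' (i x)
  have : y = 0 := by
    rw [← LinearMap.id_apply (R := A) y, ← hs, LinearMap.comp_apply, hy,
      hif.apply_apply_eq_zero]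
  rw [← hy, this, map_zero, map_zero]

/-- A projective-injective `G` mapping onto `M` lifts to the projective cover, surjectively because
the kernel is superfluous. So the cover is a summand of `G`, hence injective. -/
theorem IsSyzygy.exists_isProjInj {M K : ModuleCat.{u} A}
    (h : IsSyzygy M K) (hM : IsProjInjGenerated M) :
    ∃ (P : ModuleCat.{u} A) (i : K →ₗ[A] P) (f : P →ₗ[A] M), IsProjInj P ∧
      IsProjectiveCover f ∧ Function.Injective i ∧ Function.Exact i f := by
  obtain ⟨P, i, f, hf, hi, hif⟩ := h.exists_exact
  obtain ⟨G, g, ⟨_, _, _⟩, hg⟩ := hM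
  obtain ⟨k, hk⟩ := Module.projective_lifting_property f g hf.epi
  have := hf.projective_module
  have hP := IsRetractOf.of_surjective k (hf.surjective_of_comp k (hk ▸ hg))
  exact ⟨P, i, f, ⟨hP.finite, this, hP.injective⟩, hf, hi, hif⟩

variable [IsArtinianRing A] {I K : ModuleCat.{u} A} (hI : IsIndecInjNonProj I)
  (hK : IsSyzygy I K) (hIg : IsProjInjGenerated I)

include hI hK hIg

omit [IsArtinianRing A] in
theorem IsSyzygy.not_injective : ¬ Module.Injective A K := by
  intro h
  obtain ⟨P, i, f, ⟨_, _, _⟩, hf, hi, hif⟩ := hK.exists_isProjInj hIg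
  exact hI.2.2.2 (isRetractOf_middle_of_injective hi hif hf.epi).projective

theorem IsSyzygy.isLocalRing_end : IsLocalRing (Module.End A K) := by
  have hni := hK.not_injective hI hIg
  obtain ⟨P, i, f, ⟨_, _, _⟩, hf, hi, hif⟩ := hK.exists_isProjInj hIg
  have : Nontrivial K := by
    rw [← not_subsingleton_iff_nontrivial]
    exact fun _ => hni ⟨fun _ _ _ _ _ _ _ _ _ => ⟨0, fun _ => Subsingleton.elim _ _⟩⟩
  have := isLocalRing_end_of_finite I hI.1 hI.2.1
  exact isLocalRing_end_left hi hif hf.epi hf.bijective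

theorem IsSyzygy.nonempty_equiv {I' K' : ModuleCat.{u} A} (hI' : IsIndecInjNonProj I')
    (hK' : IsSyzygy I' K') (hIg' : IsProjInjGenerated I') (e : K ≃ₗ[A] K') :
    Nonempty (I ≃ₗ[A] I') := by
  obtain ⟨P, i, f, ⟨_, _, hPi⟩, hf, hi, hif⟩ := hK.exists_isProjInj hIg
  obtain ⟨P', i', f', ⟨_, _, hPi'⟩, hf', hi', hif'⟩ := hK'.exists_isProjInj hIg'
  have := isLocalRing_end_of_finite I hI.1 hI.2.1
  have := isLocalRing_end_of_finite I' hI'.1 hI'.2.1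
  have := nontrivial_of_isLocalRing_end (A := A) (M := I)
  obtain ⟨α, hα⟩ := hPi'.out i hi (i' ∘ₗ e.toLinearMap)
  obtain ⟨β, hβ⟩ := hPi.out i' hi' (i ∘ₗ e.symm.toLinearMap)
  rcases isRetractOf_right_or_middle hif hf.epi hif' hf'.epi e.toLinearMap e.symm.toLinearMap
    (by simp) α hα β hβ with h | h
  · exact h.nonempty_equiv
  · exact absurd h.projective hI.2.2.2

omit hIg in
/-- The syzygy of an indecomposable injective non-projective module is a summand of every
cotilting module in `𝒞`. -/
theorem IsCotilting.isRetractOf_syzygy (R : Type u) [CommRing R] [IsArtinianRing R] [Algebra R A]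
    [Module.Finite R A] {C : ModuleCat.{u} A} (hC : IsCotilting R C)
    (hCg : IsProjInjGenerated C) (hCc : IsProjInjCogenerated C) :
    IsProjInjGenerated I ∧ IsRetractOf A K C := by
  obtain ⟨C₀, C₁, f, g, hC₀, hC₁, hf, hfg, hg⟩ := hC.exists_resolution
  obtain ⟨_, hIi, _, hInp⟩ := id hI
  obtain ⟨n, k, hk⟩ := exists_injective_dualRegular R (A := A) I
  obtain ⟨s, r, hsr⟩ := IsRetractOf.of_injective k hk
  let F : (Fin n → C₁) →ₗ[A] Fin n → DualRegular R A := piMap fun _ => g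
  have hF : Function.Surjective F := piMap_surjective fun _ => hg
  have hIg : IsProjInjGenerated I := ((hC₁.isProjInjGenerated hCg).pow n).of_surjective
    (r ∘ₗ F) ((Function.LeftInverse.surjective hsr).comp hF)
  refine ⟨hIg, ?_⟩
  have hloc := hK.isLocalRing_end hI hIg
  have hni := hK.not_injective hI hIg
  obtain ⟨P, i, p, ⟨_, _, _⟩, hp, hi, hip⟩ := hK.exists_isProjInj hIg
  obtain ⟨G, h, ⟨_, _, _⟩, hh⟩ := (hC₁.isProjInjCogenerated hCc).pow n
  have := hI.2.2.1
  -- The map from the power of `C₁` to `I` extends to `G` because `I` is injective, and the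
  -- extension lifts to `P` because `G` is projective; composing with `h` gives the backward map of
  -- middle terms.
  obtain ⟨l, hl⟩ := Module.Injective.out h hh (r ∘ₗ F)
  obtain ⟨α, hα⟩ := Module.projective_lifting_property F (s ∘ₗ p) hF
  obtain ⟨β, hβ⟩ := Module.projective_lifting_property p l hp.epi
  rcases isRetractOf_left_or_middle hi hip (piMap_injective fun _ : Fin n => hf)
    (piMap_exact fun _ => hfg) s r hsr α (LinearMap.congr_fun hα) (β ∘ₗ h)
    (fun x => (LinearMap.congr_fun hβ (h x)).trans (hl x)) with h | h
  · exact hC₀.isRetractOf_of_pow h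
  · exact absurd h.injective hni

end Syzygy

/-! ### Modules in 𝒞 of injective dimension at most one. -/

section IdOne

variable {A : Type u} [Ring A] [IsArtinianRing A]

/-- Every indecomposable non-injective module in `𝒞` of injective dimension at most one is the
syzygy of an indecomposable injective non-projective module. -/
theorem IsInC.exists_equiv_syzygy {Q X : ModuleCat.{u} A} (hXC : IsInC Q X)
    (hXi : Indecomposable X) (hid : injectiveDimension X ≤ 1) (hni : ¬ Module.Injective A X)
    (hQ : IsProjInj Q) {ι : Type u} {I : ι → ModuleCat.{u} A}
    (hI : IsRepresentatives IsIndecInjNonProj I)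
    {K : ι → ModuleCat.{u} A} (hK : ∀ j, IsSyzygy (I j) (K j)) :
    ∃ j, Nonempty (X ≃ₗ[A] K j) := by
  have := hXC.finite
  have := isLocalRing_end_of_finite X hXC.finite hXi
  have := nontrivial_of_isLocalRing_end (A := A) (M := X)
  obtain ⟨G, g, ⟨_, _, _⟩, hg⟩ := hXC.isProjInjCogenerated hQ
  let J := ModuleCat.of A (G ⧸ LinearMap.range g)
  let q : G →ₗ[A] J := (LinearMap.range g).mkQ
  have hq : Function.Surjective q := Submodule.mkQ_surjective _
  have hgq : Function.Exact g q := LinearMap.exact_map_mkQ_range g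
  have : Module.Injective A J := (injectiveDimension_le_one_iff (C := J) hg hgq hq).1 hid
  have : Module.Finite A J := Module.Finite.of_surjective q hq
  obtain ⟨κ, _, N, hN, ⟨e⟩⟩ := exists_indecomposable_decomposition J
  have hret : ∀ k, IsRetractOf A (N k) J := IsRetractOf.of_equiv_pi e
  -- Projective summands of the injective cokernel `J` have zero syzygy; each other summand is a
  -- listed `I j`.
  have hsyz : ∀ k, ∃ D, IsSyzygy (N k) D ∧
      (Subsingleton D ∨ ∃ j, D = K j ∧ Nonempty (N k ≃ₗ[A] I j)) := by
    intro k
    have := (hret k).finite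
    by_cases hp : Module.Projective A (N k)
    · obtain ⟨D, hD⟩ := exists_isSyzygy (N k)
      exact ⟨D, hD, Or.inl hD.subsingleton⟩
    · obtain ⟨j, ⟨f⟩⟩ := hI.exists_iso (N k) ⟨(hret k).finite, hN k, (hret k).injective, hp⟩
      exact ⟨K j, (hK j).of_equiv f, Or.inr ⟨j, rfl, ⟨f⟩⟩⟩
  choose D hD hDK using hsyz
  choose P i p hp hi hip using fun k => (hD k).exists_exact
  have : ∀ k, Module.Projective A (P k) := fun k => (hp k).projective_module
  have := projective_pi (A := A) (M := fun k => P k)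
  have hpp : Function.Surjective (piMap p) := piMap_surjective fun k => (hp k).epi
  obtain ⟨α, hα⟩ := Module.projective_lifting_property (piMap p) (e.toLinearMap ∘ₗ q) hpp
  obtain ⟨β, hβ⟩ := Module.projective_lifting_property q (e.symm.toLinearMap ∘ₗ piMap p) hq
  rcases isRetractOf_left_or_middle hg hgq (piMap_injective hi) (piMap_exact hip)
    e.toLinearMap e.symm.toLinearMap (by simp) α (LinearMap.congr_fun hα) β
    (LinearMap.congr_fun hβ) with h | h
  · obtain ⟨k, hk⟩ := h.exists_pi (LinearEquiv.refl A _)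
    rcases hDK k with h0 | ⟨j, hj, ⟨f⟩⟩
    · obtain ⟨s, r, hsr⟩ := hk
      have := (Function.LeftInverse.injective hsr).subsingleton
      exact (not_subsingleton X this).elim
    · rw [hj] at hk
      have hIg : IsProjInjGenerated (I j) := by
        obtain ⟨s, r, hsr⟩ := hret k
        exact ⟨G, f.toLinearMap ∘ₗ r ∘ₗ q, ⟨‹_›, ‹_›, ‹_›⟩,
          f.surjective.comp ((Function.LeftInverse.surjective hsr).comp hq)⟩
      have := (hK j).isLocalRing_end (hI.prop j) hIg
      exact ⟨j, hk.nonempty_equiv⟩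
  · exact absurd h.injective hni

end IdOne

/-! ### Finiteness, partial tilting, and the shape of tilting and cotilting modules in 𝒞. -/

section Assembly

variable {A : Type u} [Ring A] [IsArtinianRing A]

/-- Each `N i` is a summand of a free module of finite rank, hence isomorphic to one of the finitely
many indecomposable summands of `A`. -/
theorem IsRepresentatives.finite_of_projective {p : ModuleCat.{u} A → Prop} {ι : Type u}
    {N : ι → ModuleCat.{u} A} (hN : IsRepresentatives p N)
    (hp : ∀ M, p M → Module.Finite A M ∧ Indecomposable M ∧ Module.Projective A M) :
    Finite ι := by
  obtain ⟨κ, _, L, hL, ⟨e⟩⟩ := exists_indecomposable_decomposition (ModuleCat.of A A)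
  have key : ∀ i, ∃ k, Nonempty (N i ≃ₗ[A] L k) := by
    intro i
    obtain ⟨_, hi, _⟩ := hp _ (hN.prop i)
    have := isLocalRing_end_of_finite (N i) ‹_› hi
    have := nontrivial_of_isLocalRing_end (A := A) (M := N i)
    obtain ⟨n, f, hf⟩ := Module.Finite.exists_fin' A (N i)
    obtain ⟨-, h1⟩ := (IsRetractOf.of_surjective f hf).exists_pi (LinearEquiv.refl A _)
    obtain ⟨k, hk⟩ := h1.exists_pi e
    have := isLocalRing_end_of_finite (L k) (IsRetractOf.of_equiv_pi e k).finite (hL k)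
    exact ⟨k, hk.nonempty_equiv⟩
  choose σ hσ using key
  exact .of_injective σ fun i j hij => by
    obtain ⟨f⟩ := hσ i
    obtain ⟨g⟩ := hσ j
    rw [← hij] at g
    exact hN.unique _ _ ⟨f ≪≫ₗ g.symm⟩

theorem IsRepresentatives.isProjInj_sumOf {ι : Type u} {Q : ι → ModuleCat.{u} A}
    (hQ : IsRepresentatives IsIndecProjInj Q) : Finite ι ∧ IsProjInj (sumOf Q) := by
  have hι : Finite ι := hQ.finite_of_projective fun M hM => ⟨hM.1, hM.2.1, hM.2.2.1⟩
  have := Fintype.ofFinite ι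
  obtain ⟨e⟩ := nonempty_sumOf_equiv_pi Q
  have : ∀ i, Module.Finite A (Q i) := fun i => (hQ.prop i).1
  have : ∀ i, Module.Projective A (Q i) := fun i => (hQ.prop i).2.2.1
  have : ∀ i, Module.Injective A (Q i) := fun i => (hQ.prop i).2.2.2
  have := projective_pi (A := A) (M := fun i => Q i)
  have hr := IsRetractOf.of_equiv (A := A) e
  exact ⟨hι, hr.finite, hr.projective, hr.injective⟩

variable {ιQ : Type u} {Q : ιQ → ModuleCat.{u} A} (hQ : IsRepresentatives IsIndecProjInj Q)

include hQ

/-- A projective module in 𝒞 splits off a projective-injective module mapping onto it, so it is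
itself injective. -/
theorem IsInC.exists_equiv_of_projective {N : ModuleCat.{u} A} (hN : IsInC (sumOf Q) N)
    (hi : Indecomposable N) (hp : Module.Projective A N) : ∃ i, Nonempty (N ≃ₗ[A] Q i) := by
  obtain ⟨G, g, ⟨_, _, _⟩, hg⟩ := hN.isProjInjGenerated hQ.isProjInj_sumOf.2
  exact hQ.exists_iso N ⟨hN.finite, hi, hp, (IsRetractOf.of_surjective g hg).injective⟩

theorem IsInC.exists_equiv_of_injective {N : ModuleCat.{u} A} (hN : IsInC (sumOf Q) N)
    (hi : Indecomposable N) (hp : Module.Injective A N) : ∃ i, Nonempty (N ≃ₗ[A] Q i) := by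
  obtain ⟨G, g, ⟨_, _, _⟩, hg⟩ := hN.isProjInjCogenerated hQ.isProjInj_sumOf.2
  exact hQ.exists_iso N ⟨hN.finite, hi, (IsRetractOf.of_injective g hg).projective, hp⟩

/-- The indecomposable projective-injective modules are summands of every tilting module. -/
theorem IsTilting.isRetractOf_projInj {T : ModuleCat.{u} A} (hT : IsTilting T) (i : ιQ) :
    IsRetractOf A (Q i) T := by
  obtain ⟨_, hi, _, _⟩ := hQ.prop i
  obtain ⟨T₀, T₁, f, g, hT₀, hT₁, hf, hfg, hg⟩ := hT.exists_coresolution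
  have := isLocalRing_end_of_finite (Q i) ‹_› hi
  obtain ⟨n, k, hk⟩ := Module.Finite.exists_fin' A (Q i)
  obtain ⟨s, r, hsr⟩ := IsRetractOf.of_surjective k hk
  -- The embedding of `Q i` in a free module, followed by the one in a power of `T₀`, splits because
  -- `Q i` is injective.
  exact hT₀.isRetractOf_of_pow (IsRetractOf.of_injective ((piMap fun _ => f) ∘ₗ s)
    ((piMap_injective fun _ => hf).comp (Function.LeftInverse.injective hsr)))

/-- The indecomposable projective-injective modules are summands of every cotilting module. -/
theorem IsCotilting.isRetractOf_projInj (R : Type u) [CommRing R] [IsArtinianRing R]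
    [Algebra R A] [Module.Finite R A] {C : ModuleCat.{u} A} (hC : IsCotilting R C) (i : ιQ) :
    IsRetractOf A (Q i) C := by
  obtain ⟨_, hi, _, _⟩ := hQ.prop i
  obtain ⟨C₀, C₁, f, g, hC₀, hC₁, hf, hfg, hg⟩ := hC.exists_resolution
  have := isLocalRing_end_of_finite (Q i) ‹_› hi
  obtain ⟨n, k, hk⟩ := exists_injective_dualRegular R (A := A) (Q i)
  obtain ⟨s, r, hsr⟩ := IsRetractOf.of_injective k hk
  exact hC₁.isRetractOf_of_pow (IsRetractOf.of_surjective (r ∘ₗ piMap fun _ => g)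
    ((Function.LeftInverse.surjective hsr).comp (piMap_surjective fun _ => hg)))

section Tilting

variable {ιX : Type u} {X : ιX → ModuleCat.{u} A}
  (hX : IsRepresentatives (IsIndecInCOfPdOne (sumOf Q)) X)
  {ιP : Type u} {P : ιP → ModuleCat.{u} A} (hP : IsRepresentatives IsIndecProjNonInj P)
  {cosyzP : ιP → ModuleCat.{u} A} (hcosyzP : ∀ i, IsCosyzygy (P i) (cosyzP i))

include hX

omit [IsArtinianRing A] in
theorem isEmpty_equiv_of_pdOne (i : ιQ) (j : ιX) : IsEmpty (Q i ≃ₗ[A] X j) := by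
  refine ⟨fun e => ?_⟩
  have := (hQ.prop i).2.2.1
  exact ((projectiveDimension_eq_one_iff _).1 (hX.prop j).2.2).2 (Module.Projective.of_equiv e)

include hP hcosyzP

theorem finite_pdOne : Finite ιX := by
  have : Finite ιP := hP.finite_of_projective fun M hM => ⟨hM.1, hM.2.1, hM.2.2.1⟩
  choose σ hσ using fun i =>
    (hX.prop i).exists_equiv_cosyzygy hQ.isProjInj_sumOf.2 hP hcosyzP
  exact .of_injective σ fun i j hij => by
    obtain ⟨f⟩ := hσ i
    obtain ⟨g⟩ := hσ j
    rw [← hij] at g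
    exact hX.unique _ _ ⟨f ≪≫ₗ g.symm⟩

theorem isPartialTilting_sumOf_prod_sumOf :
    IsPartialTilting (ModuleCat.of A (sumOf Q × sumOf X)) := by
  have hιX := finite_pdOne hQ hX hP hcosyzP
  obtain ⟨hιQ, hQ'⟩ := hQ.isProjInj_sumOf
  let Y : ιQ ⊕ ιX → ModuleCat.{u} A := Sum.elim Q X
  obtain ⟨e⟩ := nonempty_prod_sumOf_equiv_pi Q X
  obtain ⟨n, ⟨σ⟩⟩ := Finite.exists_equiv_fin (ιQ ⊕ ιX)
  let e' : (sumOf Q × sumOf X) ≃ₗ[A] ∀ k, Y (σ.symm k) :=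
    e ≪≫ₗ (LinearEquiv.piCongrLeft A (fun i => Y i) σ.symm).symm
  have hY : ∀ s, Indecomposable (Y s) ∧ Module.Finite A (Y s) ∧ projectiveDimension (Y s) ≤ 1 ∧
      IsProjInjGenerated (Y s) := by
    rintro (i | i)
    · obtain ⟨h1, h2, h3, h4⟩ := hQ.prop i
      exact ⟨h2, h1, ((projectiveDimension_le_zero_iff _).2 h3).trans zero_le_one,
        _, LinearMap.id, ⟨h1, h3, h4⟩, Function.surjective_id⟩
    · obtain ⟨h1, h2, h3⟩ := hX.prop i
      exact ⟨h1, h2.finite, h3.le, h2.isProjInjGenerated hQ'⟩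
  have hpd : projectiveDimension (ModuleCat.of A (sumOf Q × sumOf X)) ≤ 1 :=
    (IsRetractOf.projectiveDimension_le (M := ModuleCat.of A (sumOf Q × sumOf X))
      (N := ModuleCat.of A (∀ k, Y (σ.symm k))) (IsRetractOf.of_equiv e')).trans
      (projectiveDimension_pi_le_one (fun k => Y (σ.symm k)) fun k => (hY _).2.2.1)
  refine ⟨?_, ?_, hpd, ?_⟩
  · have := fun k => (hY (σ.symm k)).2.1
    exact (IsRetractOf.of_equiv e').finite
  · exact isBasic_of_equiv_pi Y (fun s => (hY s).1)
      (sum_elim_eq_of_equiv hQ.unique hX.unique (isEmpty_equiv_of_pdOne hQ hX)) e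
  · choose G g hG hg using fun k => (hY (σ.symm k)).2.2.2
    have := fun k => (hG k).injective
    exact subsingleton_ext_one (G := ModuleCat.of A (∀ k, G k)) hpd
      (hG := inferInstanceAs (Module.Injective A (∀ k, G k)))
      (e'.symm.toLinearMap ∘ₗ piMap g) (e'.symm.surjective.comp (piMap_surjective hg))

/-- Krull–Schmidt is applied to `T` with two lists of summands. Every `X i` is some cosyzygy in any
case; the tilting module is what forces every `P j` into a projective-injective module, so that
every cosyzygy occurs as a summand. -/
theorem IsTilting.nonempty_equiv {T : ModuleCat.{u} A} (hT : IsTilting T)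
    (hTC : IsInC (sumOf Q) T) :
    Nonempty (T ≃ₗ[A] (sumOf Q × sumOf X)) ∧ Nonempty (T ≃ₗ[A] (sumOf Q × sumOf cosyzP)) := by
  have hQ' := hQ.isProjInj_sumOf.2
  have hTg := hTC.isProjInjGenerated hQ'
  have hTc := hTC.isProjInjCogenerated hQ'
  have := hT.finite
  have hPc : ∀ j, IsProjInjCogenerated (P j) ∧ IsRetractOf A (cosyzP j) T := fun j =>
    hT.isRetractOf_cosyzygy (hP.prop j) (hcosyzP j) hTg hTc
  have hloc : ∀ j, IsLocalRing (Module.End A (cosyzP j)) := fun j =>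
    (hcosyzP j).isLocalRing_end (hP.prop j) (hPc j).1
  have hQloc : ∀ i, IsLocalRing (Module.End A (Q i)) := fun i =>
    isLocalRing_end_of_finite _ (hQ.prop i).1 (hQ.prop i).2.1
  have hXloc : ∀ i, IsLocalRing (Module.End A (X i)) := fun i =>
    isLocalRing_end_of_finite _ (hX.prop i).2.1.finite (hX.prop i).1
  have hXcos : ∀ i, ∃ j, Nonempty (X i ≃ₗ[A] cosyzP j) := fun i =>
    (hX.prop i).exists_equiv_cosyzygy hQ' hP hcosyzP
  have hall : ∀ N : ModuleCat.{u} A, Indecomposable N → IsRetractOf A N T →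
      (∃ i, Nonempty (N ≃ₗ[A] Q i)) ∨ ∃ i, Nonempty (N ≃ₗ[A] X i) := by
    intro N hN hNT
    have hNC := hTC.of_isRetractOf hNT
    by_cases hp : Module.Projective A N
    · exact Or.inl (hNC.exists_equiv_of_projective hQ hN hp)
    · exact Or.inr (hX.exists_iso N ⟨hN, hNC, (projectiveDimension_eq_one_iff N).2
        ⟨hNT.projectiveDimension_le.trans hT.pd_le_one, hp⟩⟩)
  refine ⟨?_, ?_⟩
  · obtain ⟨hfin, ⟨e⟩⟩ := hT.basic.nonempty_equiv_pi (Sum.elim Q X)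
      (by rintro (i | i); exacts [hQloc i, hXloc i])
      (sum_elim_eq_of_equiv hQ.unique hX.unique (isEmpty_equiv_of_pdOne hQ hX))
      (by
        rintro (i | i)
        · exact hT.isRetractOf_projInj hQ i
        · obtain ⟨j, ⟨f⟩⟩ := hXcos i
          exact (IsRetractOf.of_equiv f).trans (hPc j).2)
      (by
        intro N hN hNT
        rcases hall N hN hNT with ⟨i, h⟩ | ⟨i, h⟩
        exacts [⟨Sum.inl i, h⟩, ⟨Sum.inr i, h⟩])
    have := Finite.sum_left (α := ιQ) ιX
    have := Finite.sum_right ιQ (β := ιX)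
    obtain ⟨e'⟩ := nonempty_prod_sumOf_equiv_pi Q X
    exact ⟨e ≪≫ₗ e'.symm⟩
  · obtain ⟨hfin, ⟨e⟩⟩ := hT.basic.nonempty_equiv_pi (Sum.elim Q cosyzP)
      (by rintro (i | i); exacts [hQloc i, hloc i])
      (sum_elim_eq_of_equiv hQ.unique
        (fun i j ⟨f⟩ => hP.unique i j ((hcosyzP i).nonempty_equiv (hP.prop i) (hPc i).1
          (hP.prop j) (hcosyzP j) (hPc j).1 f))
        fun i j => ⟨fun f => by
          have := (hQ.prop i).2.2.1
          exact (hcosyzP j).not_projective (hP.prop j) (hPc j).1 (.of_equiv f)⟩)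
      (by
        rintro (i | i)
        exacts [hT.isRetractOf_projInj hQ i, (hPc i).2])
      (by
        intro N hN hNT
        rcases hall N hN hNT with ⟨i, h⟩ | ⟨i, ⟨f⟩⟩
        · exact ⟨Sum.inl i, h⟩
        · obtain ⟨j, ⟨g⟩⟩ := hXcos i
          exact ⟨Sum.inr j, ⟨f ≪≫ₗ g⟩⟩)
    have := Finite.sum_left (α := ιQ) ιP
    have := Finite.sum_right ιQ (β := ιP)
    obtain ⟨e'⟩ := nonempty_prod_sumOf_equiv_pi Q cosyzP
    exact ⟨e ≪≫ₗ e'.symm⟩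

end Tilting

theorem IsCotilting.nonempty_equiv (R : Type u) [CommRing R] [IsArtinianRing R]
    [Algebra R A] [Module.Finite R A]
    {ιI : Type u} {I : ιI → ModuleCat.{u} A} (hI : IsRepresentatives IsIndecInjNonProj I)
    {syzI : ιI → ModuleCat.{u} A} (hsyzI : ∀ i, IsSyzygy (I i) (syzI i))
    {C : ModuleCat.{u} A} (hC : IsCotilting R C) (hCC : IsInC (sumOf Q) C) :
    Nonempty (C ≃ₗ[A] (sumOf Q × sumOf syzI)) := by
  have hQ' := hQ.isProjInj_sumOf.2
  have := hC.finite
  have hIg : ∀ j, IsProjInjGenerated (I j) ∧ IsRetractOf A (syzI j) C := fun j =>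
    hC.isRetractOf_syzygy (hI.prop j) (hsyzI j) R (hCC.isProjInjGenerated hQ')
      (hCC.isProjInjCogenerated hQ')
  obtain ⟨hfin, ⟨e⟩⟩ := hC.basic.nonempty_equiv_pi (Sum.elim Q syzI)
    (by
      rintro (i | i)
      · exact isLocalRing_end_of_finite _ (hQ.prop i).1 (hQ.prop i).2.1
      · exact (hsyzI i).isLocalRing_end (hI.prop i) (hIg i).1)
    (sum_elim_eq_of_equiv hQ.unique
      (fun i j ⟨f⟩ => hI.unique i j ((hsyzI i).nonempty_equiv (hI.prop i) (hIg i).1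
        (hI.prop j) (hsyzI j) (hIg j).1 f))
      fun i j => ⟨fun f => by
        have := (hQ.prop i).2.2.2
        exact (hsyzI j).not_injective (hI.prop j) (hIg j).1
          (IsRetractOf.of_equiv f.symm).injective⟩)
    (by
      rintro (i | i)
      exacts [hC.isRetractOf_projInj hQ R i, (hIg i).2])
    (by
      intro N hN hNC
      have hNC' := hCC.of_isRetractOf hNC
      by_cases hi : Module.Injective A N
      · obtain ⟨i, h⟩ := hNC'.exists_equiv_of_injective hQ hN hi
        exact ⟨Sum.inl i, h⟩
      · obtain ⟨j, h⟩ := hNC'.exists_equiv_syzygy hN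
          (hNC.injectiveDimension_le.trans hC.id_le_one) hi hQ' hI hsyzI
        exact ⟨Sum.inr j, h⟩)
  have := Finite.sum_left (α := ιQ) ιI
  have := Finite.sum_right ιQ (β := ιI)
  obtain ⟨e'⟩ := nonempty_prod_sumOf_equiv_pi Q syzI
  exact ⟨e ≪≫ₗ e'.symm⟩

end Assembly

end TiltingC

theorem mainTheorem3 (R Λ : Type u) [CommRing R] [IsArtinianRing R] [Ring Λ] [Algebra R Λ]
    [Module.Finite R Λ]
    -- representatives of the indecomposable projective-injective modules, with direct sum `Q̃`
    {ιQ : Type u} (Q : ιQ → ModuleCat.{u} Λ) (hQ : IsRepresentatives IsIndecProjInj Q)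
    -- representatives of the indecomposable modules in `𝒞` of projective dimension one
    {ιX : Type u} (X : ιX → ModuleCat.{u} Λ)
    (hX : IsRepresentatives (IsIndecInCOfPdOne (sumOf Q)) X)
    -- representatives of the indecomposable projective non-injective modules, their cosyzygies
    {ιP : Type u} (P : ιP → ModuleCat.{u} Λ) (hP : IsRepresentatives IsIndecProjNonInj P)
    (cosyzP : ιP → ModuleCat.{u} Λ) (hcosyzP : ∀ i, IsCosyzygy (P i) (cosyzP i))
    -- representatives of the indecomposable injective non-projective modules, their syzygies
    {ιI : Type u} (I : ιI → ModuleCat.{u} Λ) (hI : IsRepresentatives IsIndecInjNonProj I)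
    (syzI : ιI → ModuleCat.{u} Λ) (hsyzI : ∀ i, IsSyzygy (I i) (syzI i)) :
    Finite ιX ∧
    IsPartialTilting (ModuleCat.of Λ (sumOf Q × sumOf X)) ∧
    (∀ T : ModuleCat.{u} Λ, IsTilting T → IsInC (sumOf Q) T →
      Nonempty (T ≃ₗ[Λ] (sumOf Q × sumOf X)) ∧
      Nonempty (T ≃ₗ[Λ] (sumOf Q × sumOf cosyzP))) ∧
    (∀ T T' : ModuleCat.{u} Λ, IsTilting T → IsInC (sumOf Q) T →
      IsTilting T' → IsInC (sumOf Q) T' → Nonempty (T ≃ₗ[Λ] T')) ∧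
    (∀ C : ModuleCat.{u} Λ, IsCotilting R C → IsInC (sumOf Q) C →
      Nonempty (C ≃ₗ[Λ] (sumOf Q × sumOf syzI))) ∧
    (∀ C C' : ModuleCat.{u} Λ, IsCotilting R C → IsInC (sumOf Q) C →
      IsCotilting R C' → IsInC (sumOf Q) C' → Nonempty (C ≃ₗ[Λ] C')) := by
  -- This is what gives finitely generated Λ-modules finite length.
  have : IsArtinianRing Λ := .of_finite R Λ
  have tilt := fun (T : ModuleCat.{u} Λ) (hT : IsTilting T) (hTC : IsInC (sumOf Q) T) =>
    hT.nonempty_equiv hQ hX hP hcosyzP hTC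
  have cotilt := fun (C : ModuleCat.{u} Λ) (hC : IsCotilting R C) (hCC : IsInC (sumOf Q) C) =>
    hC.nonempty_equiv hQ R hI hsyzI hCC
  refine ⟨finite_pdOne hQ hX hP hcosyzP, isPartialTilting_sumOf_prod_sumOf hQ hX hP hcosyzP,
    tilt, fun T T' hT hTC hT' hTC' => ?_, cotilt, fun C C' hC hCC hC' hCC' => ?_⟩
  · exact ⟨(tilt T hT hTC).1.some ≪≫ₗ (tilt T' hT' hTC').1.some.symm⟩
  · exact ⟨(cotilt C hC hCC).some ≪≫ₗ (cotilt C' hC' hCC').some.symm⟩
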